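/- Let $S_4$ be generated by the simple reflections $s_i=(i\ i{+}1)$, $i=1,2,3$, and write $ijk\cdots$ for $s_is_js_k\cdots$. For $w\in S_4$ let $\mathrm{Rex}(w)$ be the graph whose vertices are the reduced expressions of $w$, two of them being joined by an edge if they differ by a single braid relation $s_is_j=s_js_i$ with $|i-j|\ge 2$ (a distant edge) or $s_is_js_i=s_js_is_j$ with $|i-j|=1$ (an adjacent edge). The conflated expression graph $\Gamma_w$ is the quotient of $\mathrm{Rex}(w)$ by its distant edges, multiple edges being merged. Let $R=\mathbb R[x_1,x_2,x_3,x_4]$ with $\deg x_k=2$, let $s_i$ act on $R$ by exchanging $x_i$ and $x_{i+1}$, let $R^{s_i}$ be the ring of $s_i$-invariants, and let $B_i=R\otimes_{R^{s_i}}R(1)$, a graded $R$-bimodule. To a word $i_1\cdots i_k$ one attaches the Bott–Samelson bimodule $B_{i_1}\otimes_R\cdots\otimes_RB_{i_k}=R\otimes_{R^{s_{i_1}}}R\otimes\cdots\otimes_{R^{s_{i_k}}}R\,(k)$ and its element $1^\otimes=1\otimes\cdots\otimes1$. For $|i-j|\ge2$ let $f_{ij}:B_iB_j\to B_jB_i$,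 and for $|i-j|=1$ let $f_{ij}:B_iB_jB_i\to B_jB_iB_j$, be the unique bimodule morphism of degree $0$ with $f_{ij}(1^\otimes)=1^\otimes$. An edge of $\mathrm{Rex}(w)$, followed in a given direction, induces the morphism $\mathrm{Id}\otimes f_{ij}\otimes\mathrm{Id}$ between the corresponding Bott–Samelson bimodules, and a path $p$ in $\mathrm{Rex}(w)$ induces the composition $f(p)$ of the morphisms of its edges. A path is complete if it passes through every vertex of $\mathrm{Rex}(w)$. The Forking Path Conjecture (FPC) for $w$ is the assertion that $f(p)=f(q)$ for any two complete paths $p,q$ in $\mathrm{Rex}(w)$ with the same starting point and the same ending point. **Proposition.** For $S_4$, the morphisms $f_{ij}$ exist and are unique, and: 1. $\Gamma_{23121}$ is a line with three vertices, and the FPC holds for $23121$. 2. The FPC holds for $12312$. 3. The FPC holds for every $w\in S_4$ other than $12321$ and the longest element $w_0$. -/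

import Mathlib

open scoped TensorProduct

noncomputable section

namespace ForkingPath

/-! Throughout, `n` is the rank: the group is `S_{n+1} = Equiv.Perm (Fin (n + 1))`, and the letter
`i : Fin n` stands for the simple reflection exchanging `i` and `i + 1` (counted from `0`). -/

/-- The simple reflection `s_i`, the transposition of `i` and `i + 1`. -/
def simpleRefl {n : ℕ} (i : Fin n) : Equiv.Perm (Fin (n + 1)) :=
  Equiv.swap i.castSucc i.succ

/-- The element of the symmetric group expressed by a word. -/
def wordProd {n : ℕ} (w : List (Fin n)) : Equiv.Perm (Fin (n + 1)) :=
  (w.map simpleRefl).prod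

/-- `w` is a reduced expression of `σ`: an expression of `σ` of minimal length. -/
def IsReducedExpr {n : ℕ} (σ : Equiv.Perm (Fin (n + 1))) (w : List (Fin n)) : Prop :=
  wordProd w = σ ∧ ∀ w' : List (Fin n), wordProd w' = σ → w.length ≤ w'.length

/-- `|i - j| ≥ 2`, that is `m_{ij} = 2`. -/
def Distant {n : ℕ} (i j : Fin n) : Prop :=
  (i : ℕ) + 2 ≤ j ∨ (j : ℕ) + 2 ≤ i

/-- `|i - j| = 1`, that is `m_{ij} = 3`. -/
def Adjacent {n : ℕ} (i j : Fin n) : Prop :=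
  (i : ℕ) + 1 = j ∨ (j : ℕ) + 1 = i

theorem Distant.ne {n : ℕ} {i j : Fin n} (h : Distant i j) : i ≠ j := by
  rintro rfl; rcases h with h | h <;> omega

theorem Adjacent.ne {n : ℕ} {i j : Fin n} (h : Adjacent i j) : i ≠ j := by
  rintro rfl; rcases h with h | h <;> omega

theorem Distant.symm {n : ℕ} {i j : Fin n} (h : Distant i j) : Distant j i := Or.symm h

theorem Adjacent.symm {n : ℕ} {i j : Fin n} (h : Adjacent i j) : Adjacent j i := Or.symm h

/-! ### Braid moves, the reduced expression graph and the conflated expression graph -/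

/-- `BraidMove w w'` is the type of ways to pass from the word `w` to the word `w'` by applying a
single braid relation to consecutive letters. -/
inductive BraidMove {n : ℕ} : List (Fin n) → List (Fin n) → Type
  | distant (i j : Fin n) (h : Distant i j) (v : List (Fin n)) :
      BraidMove (i :: j :: v) (j :: i :: v)
  | adjacent (i j : Fin n) (h : Adjacent i j) (v : List (Fin n)) :
      BraidMove (i :: j :: i :: v) (j :: i :: j :: v)
  | cons (a : Fin n) {w w' : List (Fin n)} (m : BraidMove w w') :
      BraidMove (a :: w) (a :: w')

/-- The move uses a relation `s_i s_j = s_j s_i` with `|i - j| ≥ 2`. -/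
def BraidMove.IsDistant {n : ℕ} : {w w' : List (Fin n)} → BraidMove w w' → Prop
  | _, _, .distant _ _ _ _ => True
  | _, _, .adjacent _ _ _ _ => False
  | _, _, .cons _ m => m.IsDistant

/-- The same move, read backwards. -/
def BraidMove.symm {n : ℕ} : {w w' : List (Fin n)} → BraidMove w w' → BraidMove w' w
  | _, _, .distant i j h v => .distant j i h.symm v
  | _, _, .adjacent i j h v => .adjacent j i h.symm v
  | _, _, .cons a m => .cons a m.symm

theorem BraidMove.ne {n : ℕ} : {w w' : List (Fin n)} → BraidMove w w' → w ≠ w'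
  | _, _, .distant _ _ h _ => fun e => h.ne (List.cons.inj e).1
  | _, _, .adjacent _ _ h _ => fun e => h.ne (List.cons.inj e).1
  | _, _, .cons _ m => fun e => m.ne (List.cons.inj e).2

/-- Two words are related by at most one braid move. -/
instance {n : ℕ} (w w' : List (Fin n)) : Subsingleton (BraidMove w w') := by
  constructor
  intro m m'
  induction m with
  | distant i j h v =>
    cases m' with
    | distant => rfl
    | adjacent => exact absurd rfl h.ne
    | cons => exact absurd rfl h.ne
  | adjacent i j h v =>
    cases m' with
    | distant => exact absurd rfl h.ne
    | adjacent => rfl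
    | cons => exact absurd rfl h.ne
  | cons a m ih =>
    cases m' with
    | distant _ _ h => exact absurd rfl h.ne
    | adjacent _ _ h => exact absurd rfl h.ne
    | cons _ m' => rw [ih m']

/-- The vertices of the reduced expression graph of `σ`. -/
def ReducedExpr {n : ℕ} (σ : Equiv.Perm (Fin (n + 1))) : Type :=
  {w : List (Fin n) // IsReducedExpr σ w}

/-- The reduced expression graph `Rex(σ)`. -/
def rexGraph {n : ℕ} (σ : Equiv.Perm (Fin (n + 1))) : SimpleGraph (ReducedExpr σ) where
  Adj v w := Nonempty (BraidMove v.1 w.1)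
  symm := ⟨fun _ _ ⟨m⟩ => ⟨m.symm⟩⟩
  loopless := ⟨fun _ ⟨m⟩ => m.ne rfl⟩

/-- Two reduced expressions joined by a distant edge. -/
def DistantEdge {n : ℕ} {σ : Equiv.Perm (Fin (n + 1))} (v w : ReducedExpr σ) : Prop :=
  ∃ m : BraidMove v.1 w.1, m.IsDistant

/-- The conflated expression graph `Γ_σ`: the quotient of the reduced expression graph by its
distant edges, multiple edges being merged. -/
def conflatedGraph {n : ℕ} (σ : Equiv.Perm (Fin (n + 1))) :
    SimpleGraph (Quot (DistantEdge (σ := σ))) :=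
  SimpleGraph.fromRel fun a b =>
    ∃ v w : ReducedExpr σ, Quot.mk _ v = a ∧ Quot.mk _ w = b ∧ (rexGraph σ).Adj v w

/-! ### Bott-Samelson bimodules -/

/-- The polynomial ring `R = ℝ[x_0, …, x_n]`. -/
abbrev Poly (n : ℕ) : Type := MvPolynomial (Fin (n + 1)) ℝ

/-- The ring `R^{s_i}` of polynomials invariant under exchanging the variables `x_i, x_{i+1}`. -/
def invariants {n : ℕ} (i : Fin n) : Subalgebra ℝ (Poly n) :=
  AlgHom.equalizer (MvPolynomial.rename (simpleRefl i)) (AlgHom.id ℝ (Poly n))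

/-- The Bott-Samelson bimodule of the word `i_1 i_2 … i_k`, that is
`B_{i_1} ⊗_R ⋯ ⊗_R B_{i_k} = R ⊗_{R^{i_1}} (R ⊗_{R^{i_2}} (⋯ ⊗_{R^{i_k}} R))`, as an algebra over
`R` acting on the leftmost factor. Being a tensor product of commutative algebras it carries a
product, in which `1` is the element `1 ⊗ 1 ⊗ ⋯ ⊗ 1`. -/
def bsAlg {n : ℕ} : List (Fin n) → CommAlgCat.{0} (Poly n)
  | [] => CommAlgCat.of (Poly n) (Poly n)
  | i :: w => CommAlgCat.of (Poly n) (Poly n ⊗[invariants i] (bsAlg w : Type))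

/-- The underlying type of the Bott-Samelson bimodule of a word. -/
abbrev BS {n : ℕ} (w : List (Fin n)) : Type := bsAlg w

/-- The right action of `R` on a Bott-Samelson bimodule is multiplication by elements
`1 ⊗ ⋯ ⊗ 1 ⊗ r`; this is the map `r ↦ 1 ⊗ ⋯ ⊗ 1 ⊗ r`. -/
def right {n : ℕ} : (w : List (Fin n)) → Poly n →+* BS w
  | [] => RingHom.id (Poly n)
  | i :: w => (Algebra.TensorProduct.includeRight (R := invariants i) (A := Poly n)
      (B := BS w)).toRingHom.comp (right w)

/-- The component of degree `d` of a Bott-Samelson bimodule. The variables have degree `2`, and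
each factor `B_i = R ⊗_{R^i} R (1)` lowers the degree by `1`, so that `1 ⊗ ⋯ ⊗ 1` has degree minus
the length of the word. -/
def gradedPiece {n : ℕ} : (w : List (Fin n)) → ℤ → AddSubgroup (BS w)
  | [], d => AddSubgroup.closure
      {p : Poly n | ∃ k : ℕ, MvPolynomial.IsHomogeneous p k ∧ 2 * (k : ℤ) = d}
  | i :: w, d => AddSubgroup.closure
      {t : Poly n ⊗[invariants i] BS w | ∃ (k : ℕ) (e : ℤ) (p : Poly n) (m : BS w),
        MvPolynomial.IsHomogeneous p k ∧ m ∈ gradedPiece w e ∧ 2 * (k : ℤ) - 1 + e = d ∧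
        t = p ⊗ₜ[invariants i] m}

/-- Homomorphisms of `R`-bimodules between Bott-Samelson bimodules. -/
@[ext]
structure BSHom {n : ℕ} (w w' : List (Fin n)) extends BS w →ₗ[Poly n] BS w' where
  map_right' : ∀ (m : BS w) (r : Poly n),
    toLinearMap (m * right w r) = toLinearMap m * right w' r

theorem baseChange_mul_right {n : ℕ} (i : Fin n) {M N : Type} [CommRing M] [Algebra (Poly n) M]
    [CommRing N] [Algebra (Poly n) N] (f : M →ₗ[invariants i] N) (c : M) (d : N)
    (h : ∀ m, f (m * c) = f m * d) (t : Poly n ⊗[invariants i] M) :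
    LinearMap.baseChange (Poly n) f (t * (1 ⊗ₜ[invariants i] c)) =
      LinearMap.baseChange (Poly n) f t * (1 ⊗ₜ[invariants i] d) := by
  induction t using TensorProduct.induction_on with
  | zero => simp
  | tmul p b => simp [h]
  | add s t hs ht => rw [add_mul, map_add, hs, ht, map_add, add_mul]

namespace BSHom

variable {n : ℕ}

instance (w w' : List (Fin n)) : CoeFun (BSHom w w') (fun _ => BS w → BS w') :=
  ⟨fun f => f.toLinearMap⟩

/-- The identity. -/
def id (w : List (Fin n)) : BSHom w w := ⟨LinearMap.id, fun _ _ => rfl⟩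

/-- Composition: first `f`, then `g`. -/
def comp {w w' w'' : List (Fin n)} (g : BSHom w' w'') (f : BSHom w w') : BSHom w w'' :=
  ⟨g.toLinearMap ∘ₗ f.toLinearMap, fun m r => by
    simp [f.map_right', g.map_right']⟩

instance (w w' : List (Fin n)) : Inhabited (BSHom w w') :=
  ⟨⟨0, fun _ _ => by simp⟩⟩

/-- `f` has degree `0`. -/
def IsDegreeZero {w w' : List (Fin n)} (f : BSHom w w') : Prop :=
  ∀ (d : ℤ) (m : BS w), m ∈ gradedPiece w d → f m ∈ gradedPiece w' d

/-- `Id ⊗ f`, with the identity of `B_a` on the left. -/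
def whiskerLeft (a : Fin n) {w w' : List (Fin n)} (f : BSHom w w') :
    BSHom (a :: w) (a :: w') where
  toLinearMap := LinearMap.baseChange (Poly n) (f.toLinearMap.restrictScalars (invariants a))
  map_right' m r :=
    baseChange_mul_right a (f.toLinearMap.restrictScalars (invariants a)) (right w r) (right w' r)
      (fun b => f.map_right' b r) m

/-- `Id ⊗ f` sends `p ⊗ m` to `p ⊗ f(m)`. -/
theorem whiskerLeft_apply (a : Fin n) {w w' : List (Fin n)} (f : BSHom w w') (p : Poly n)
    (m : BS w) : f.whiskerLeft a (p ⊗ₜ[invariants a] m) = p ⊗ₜ[invariants a] f m := rfl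

end BSHom

/-! The tensor product over `R` of two Bott-Samelson bimodules is the Bott-Samelson bimodule of the
concatenated word; both directions of this identification are written out in order to define
`f ⊗ Id`. -/

section Concat

variable {n : ℕ}

/-- A Bott-Samelson bimodule, as an algebra over `R` acting on the rightmost factor. -/
def RightBS (w : List (Fin n)) : Type := BS w

instance (w : List (Fin n)) : CommRing (RightBS w) := inferInstanceAs (CommRing (BS w))

instance (w : List (Fin n)) : Algebra (Poly n) (RightBS w) := (right w).toAlgebra

/-- The tensor product `B_x ⊗_R B_v`, where `R` acts on the right of `B_x` and on the left of
`B_v`. -/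
def Tens (x v : List (Fin n)) : Type := RightBS x ⊗[Poly n] BS v

instance (x v : List (Fin n)) : CommRing (Tens x v) :=
  inferInstanceAs (CommRing (RightBS x ⊗[Poly n] BS v))

/-- The pure tensor `b ⊗ c` in `B_x ⊗_R B_v`. -/
def Tens.mk {x v : List (Fin n)} (b : BS x) (c : BS v) : Tens x v :=
  (show RightBS x from b) ⊗ₜ[Poly n] c

/-- `b ↦ b ⊗ 1`, from `B_x` to `B_x ⊗_R B_v`. -/
def Tens.inl (x v : List (Fin n)) : BS x →+* Tens x v :=
  (Algebra.TensorProduct.includeLeft (R := Poly n) (S := Poly n) (A := RightBS x)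
    (B := BS v)).toRingHom

/-- The left action of `R` on `B_x ⊗_R B_v`. -/
instance (x v : List (Fin n)) : Algebra (Poly n) (Tens x v) :=
  ((Tens.inl x v).comp (algebraMap (Poly n) (BS x))).toAlgebra

/-- `m ↦ 1 ⊗ m`, from `B_x` to `B_i ⊗_R B_x`. -/
def RightBS.cons (i : Fin n) (x : List (Fin n)) : RightBS x →ₐ[Poly n] RightBS (i :: x) :=
  { (Algebra.TensorProduct.includeRight (R := invariants i) (A := Poly n)
      (B := BS x)).toRingHom with commutes' := fun _ => rfl }

theorem RightBS.cons_algebraMap (i : Fin n) (x : List (Fin n)) (r : invariants i) :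
    RightBS.cons i x (algebraMap (Poly n) (BS x) r) = algebraMap (Poly n) (BS (i :: x)) r := by
  change (1 : Poly n) ⊗ₜ[invariants i] (algebraMap (Poly n) (BS x) r) =
    (r : Poly n) ⊗ₜ[invariants i] (1 : BS x)
  have h := TensorProduct.smul_tmul (R := invariants i) r (1 : Poly n) (1 : BS x)
  rw [Algebra.algebraMap_eq_smul_one]
  refine h.symm.trans ?_
  congr 1
  exact mul_one (r : Poly n)

/-- `m ⊗ c ↦ (1 ⊗ m) ⊗ c`, from `B_x ⊗_R B_v` to `B_{ix} ⊗_R B_v`. -/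
def Tens.cons (i : Fin n) (x v : List (Fin n)) : Tens x v →ₐ[invariants i] Tens (i :: x) v :=
  { (Algebra.TensorProduct.map (RightBS.cons i x) (AlgHom.id (Poly n) (BS v))).toRingHom with
    commutes' := fun r => congrArg (fun t => t ⊗ₜ[Poly n] (1 : BS v))
      (RightBS.cons_algebraMap i x r) }

/-- The identification of `B_{xv}` with `B_x ⊗_R B_v`. -/
def split : (x v : List (Fin n)) → BS (x ++ v) →ₐ[Poly n] Tens x v
  | [], v => { (Algebra.TensorProduct.includeRight (R := Poly n) (A := RightBS [])
      (B := BS v)).toRingHom with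
      commutes' := fun r => (Algebra.TensorProduct.tmul_one_eq_one_tmul (R := Poly n)
        (A := RightBS []) (B := BS v) r).symm }
  | i :: x, v => Algebra.TensorProduct.lift (R := invariants i) (S := Poly n) (A := Poly n) (B := BS (x ++ v))
      (Algebra.ofId (Poly n) (Tens (i :: x) v))
      ((Tens.cons i x v).comp ((split x v).restrictScalars (invariants i)))
      (fun _ _ => Commute.all _ _)

/-- `b ↦ b ⊗ 1`, from `B_x` to `B_{xv}`. -/
def inl : (x v : List (Fin n)) → BS x →ₐ[Poly n] BS (x ++ v)
  | [], v => Algebra.ofId (Poly n) (BS v)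
  | i :: x, v => Algebra.TensorProduct.map (AlgHom.id (Poly n) (Poly n))
      ((inl x v).restrictScalars (invariants i))

/-- `c ↦ 1 ⊗ c`, from `B_v` to `B_{xv}`. -/
def inr : (x v : List (Fin n)) → BS v →+* BS (x ++ v)
  | [], v => RingHom.id (BS v)
  | i :: x, v => (Algebra.TensorProduct.includeRight (R := invariants i) (A := Poly n)
      (B := BS (x ++ v))).toRingHom.comp (inr x v)

theorem inl_right : (x v : List (Fin n)) → (r : Poly n) →
    inl x v (right x r) = inr x v (algebraMap (Poly n) (BS v) r)
  | [], _, _ => rfl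
  | i :: x, v, r => by
    change Algebra.TensorProduct.map (AlgHom.id (Poly n) (Poly n))
      ((inl x v).restrictScalars (invariants i)) ((1 : Poly n) ⊗ₜ[invariants i] right x r) =
      (1 : Poly n) ⊗ₜ[invariants i] inr x v (algebraMap (Poly n) (BS v) r)
    rw [← inl_right x v r]
    exact Algebra.TensorProduct.map_tmul _ _ _ _

theorem inr_right : (x v : List (Fin n)) → (r : Poly n) →
    inr x v (right v r) = right (x ++ v) r
  | [], _, _ => rfl
  | i :: x, v, r => congrArg (fun m => (1 : Poly n) ⊗ₜ[invariants i] m) (inr_right x v r)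

/-- The identification of `B_x ⊗_R B_v` with `B_{xv}`: the map `b ⊗ c ↦ (b ⊗ 1) (1 ⊗ c)`. -/
def join (x v : List (Fin n)) : Tens x v →+ BS (x ++ v) :=
  TensorProduct.liftAddHom (R := Poly n) (M := RightBS x) (N := BS v)
    ((AddMonoidHom.mul.comp (inl x v).toRingHom.toAddMonoidHom).compl₂ (inr x v).toAddMonoidHom)
    (fun r b c => by
      change inl x v ((right x r : BS x) * (show BS x from b)) * inr x v c =
        inl x v (show BS x from b) * inr x v (r • c)
      rw [map_mul, inl_right, Algebra.smul_def, map_mul]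
      ring)

theorem join_mk {x v : List (Fin n)} (b : BS x) (c : BS v) :
    join x v (Tens.mk b c) = inl x v b * inr x v c := rfl

theorem Tens.induction {x v : List (Fin n)} {P : Tens x v → Prop} (t : Tens x v) (h0 : P 0)
    (h1 : ∀ (b : BS x) (c : BS v), P (Tens.mk b c)) (h2 : ∀ s t, P s → P t → P (s + t)) : P t :=
  TensorProduct.induction_on (motive := P) t h0 h1 h2

theorem Tens.mk_mul {x v : List (Fin n)} (b b' : BS x) (c c' : BS v) :
    Tens.mk b c * Tens.mk b' c' = Tens.mk (b * b') (c * c') :=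
  Algebra.TensorProduct.tmul_mul_tmul (R := Poly n) (A := RightBS x) (B := BS v) b b' c c'

theorem Tens.smul_mk {x v : List (Fin n)} (r : Poly n) (b : BS x) (c : BS v) :
    r • Tens.mk b c = Tens.mk (r • b) c := by
  rw [Algebra.smul_def, Algebra.smul_def]
  exact (Tens.mk_mul _ b 1 c).trans (by rw [one_mul])

/-- A bimodule homomorphism, as a linear map for the right actions. -/
def BSHom.toRight {x y : List (Fin n)} (f : BSHom x y) : RightBS x →ₗ[Poly n] RightBS y where
  toFun b := f (show BS x from b)
  map_add' a b := f.toLinearMap.map_add a b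
  map_smul' r b := by
    change f ((right x r : BS x) * (show BS x from b)) = right y r * f (show BS x from b)
    rw [mul_comm, f.map_right', mul_comm]

/-- `f ⊗ Id`, from `B_x ⊗_R B_v` to `B_y ⊗_R B_v`. -/
def Tens.map {x y : List (Fin n)} (f : BSHom x y) (v : List (Fin n)) : Tens x v →+ Tens y v :=
  (TensorProduct.map (f.toRight) (LinearMap.id (R := Poly n) (M := BS v))).toAddMonoidHom

theorem Tens.map_mk {x y : List (Fin n)} (f : BSHom x y) {v : List (Fin n)} (b : BS x)
    (c : BS v) : Tens.map f v (Tens.mk b c) = Tens.mk (f b) c := rfl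

theorem Tens.map_smul {x y : List (Fin n)} (f : BSHom x y) (v : List (Fin n)) (r : Poly n)
    (t : Tens x v) : Tens.map f v (r • t) = r • Tens.map f v t := by
  induction t using Tens.induction with
  | h0 => simp
  | h1 b c => rw [Tens.smul_mk, Tens.map_mk, Tens.map_mk, Tens.smul_mk, f.toLinearMap.map_smul]
  | h2 s t hs ht => rw [smul_add, map_add, hs, ht, map_add, smul_add]

theorem Tens.map_mul_right {x y : List (Fin n)} (f : BSHom x y) (v : List (Fin n)) (c : BS v)
    (t : Tens x v) :
    Tens.map f v (t * Tens.mk 1 c) = Tens.map f v t * Tens.mk 1 c := by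
  induction t using Tens.induction with
  | h0 => simp
  | h1 b c' => rw [Tens.mk_mul, Tens.map_mk, Tens.map_mk, Tens.mk_mul, mul_one, mul_one]
  | h2 s t hs ht => rw [add_mul, map_add, hs, ht, map_add, add_mul]

theorem join_smul (x v : List (Fin n)) (r : Poly n) (t : Tens x v) :
    join x v (r • t) = r • join x v t := by
  induction t using Tens.induction with
  | h0 => simp
  | h1 b c => rw [Tens.smul_mk, join_mk, join_mk, map_smul, smul_mul_assoc]
  | h2 s t hs ht => rw [smul_add, map_add, hs, ht, map_add, smul_add]

theorem join_mul_right (x v : List (Fin n)) (c : BS v) (t : Tens x v) :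
    join x v (t * Tens.mk 1 c) = join x v t * inr x v c := by
  induction t using Tens.induction with
  | h0 => simp
  | h1 b c' => rw [Tens.mk_mul, join_mk, join_mk, mul_one, map_mul, mul_assoc]
  | h2 s t hs ht => rw [add_mul, map_add, hs, ht, map_add, add_mul]

theorem Tens.cons_mk (i : Fin n) {x v : List (Fin n)} (b : BS x) (c : BS v) :
    Tens.cons i x v (Tens.mk b c) = Tens.mk (x := i :: x) (RightBS.cons i x b) c := rfl

theorem split_inr : (x v : List (Fin n)) → (c : BS v) → split x v (inr x v c) = Tens.mk 1 c
  | [], _, _ => rfl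
  | i :: x, v, c => by
    have h : split (i :: x) v (inr (i :: x) v c) = Tens.cons i x v (split x v (inr x v c)) :=
      (Algebra.TensorProduct.lift_tmul _ _ _ _ _).trans (by simp)
    rw [h, split_inr x v c, Tens.cons_mk]
    exact congrArg (fun b => Tens.mk (x := i :: x) b c) (map_one (RightBS.cons i x))

theorem BS.cons_induction {i : Fin n} {x : List (Fin n)} {P : BS (i :: x) → Prop}
    (b : BS (i :: x)) (h0 : P 0)
    (h1 : ∀ (r : Poly n) (m : BS x), P (r ⊗ₜ[invariants i] m))
    (h2 : ∀ s t, P s → P t → P (s + t)) : P b :=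
  TensorProduct.induction_on (motive := P) b h0 h1 h2

theorem split_inl : (x v : List (Fin n)) → (b : BS x) → split x v (inl x v b) = Tens.mk b 1
  | [], v, b => (Algebra.TensorProduct.tmul_one_eq_one_tmul (R := Poly n)
      (A := RightBS []) (B := BS v) b).symm
  | i :: x, v, b => by
    induction b using BS.cons_induction with
    | h0 =>
      rw [map_zero, map_zero]
      exact (TensorProduct.zero_tmul (R := Poly n) (RightBS (i :: x)) (1 : BS v)).symm
    | h1 r m =>
      have h : split (i :: x) v (inl (i :: x) v (r ⊗ₜ[invariants i] m)) =
          r • Tens.cons i x v (split x v (inl x v m)) := by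
        refine (congrArg (split (i :: x) v) (Algebra.TensorProduct.map_tmul _ _ _ _)).trans ?_
        refine (Algebra.TensorProduct.lift_tmul _ _ _ _ _).trans ?_
        rw [Algebra.smul_def]
        rfl
      rw [h, split_inl x v m]
      refine (Tens.smul_mk (x := i :: x) r (RightBS.cons i x m) (1 : BS v)).trans ?_
      refine congrArg (fun b => Tens.mk (x := i :: x) b (1 : BS v)) ?_
      change (r * 1 : Poly n) ⊗ₜ[invariants i] m = r ⊗ₜ[invariants i] m
      rw [mul_one]
    | h2 s t hs ht =>
      rw [map_add, map_add, hs, ht]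
      exact (TensorProduct.add_tmul (R := Poly n) (show RightBS (i :: x) from s) t (1 : BS v)).symm

end Concat

/-- `f ⊗ Id`, with the identity of `B_v` on the right. -/
def BSHom.whiskerRight {n : ℕ} {x y : List (Fin n)} (f : BSHom x y) (v : List (Fin n)) :
    BSHom (x ++ v) (y ++ v) where
  toFun m := join y v (Tens.map f v (split x v m))
  map_add' a b := by simp
  map_smul' r m := by simp [Tens.map_smul, join_smul]
  map_right' m r := by
    change join y v (Tens.map f v (split x v (m * right (x ++ v) r))) =
      join y v (Tens.map f v (split x v m)) * right (y ++ v) r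
    rw [← inr_right, map_mul, split_inr, Tens.map_mul_right, join_mul_right, inr_right]

/-- `f ⊗ Id` sends `b ⊗ c` to `f(b) ⊗ c`. -/
theorem BSHom.whiskerRight_apply {n : ℕ} {x y : List (Fin n)} (f : BSHom x y) (v : List (Fin n))
    (b : BS x) (c : BS v) :
    f.whiskerRight v (inl x v b * inr x v c) = inl y v (f b) * inr y v c := by
  change join y v (Tens.map f v (split x v (inl x v b * inr x v c))) = _
  rw [map_mul, split_inl, split_inr, Tens.mk_mul, mul_one, one_mul, Tens.map_mk, join_mk]

/-! ### Path morphisms -/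

/-- `f` has degree `0` and sends `1 ⊗ ⋯ ⊗ 1` to `1 ⊗ ⋯ ⊗ 1`. -/
def IsBraidMorphism {n : ℕ} {x y : List (Fin n)} (f : BSHom x y) : Prop :=
  f.IsDegreeZero ∧ f 1 = 1

/-- The degree `0` morphism from `B_x` to `B_y` sending `1 ⊗ ⋯ ⊗ 1` to `1 ⊗ ⋯ ⊗ 1`. It is only used
for `x = i j`, `y = j i` with `i, j` distant, and for `x = i j i`, `y = j i j` with `i, j` adjacent,
where it is the braid morphism `f_{ij}`. -/
def braidMorphism {n : ℕ} (x y : List (Fin n)) : BSHom x y :=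
  Classical.epsilon IsBraidMorphism

/-- The morphism `Id ⊗ f_{ij} ⊗ Id` of a braid move. -/
def BraidMove.morphism {n : ℕ} : {w w' : List (Fin n)} → BraidMove w w' → BSHom w w'
  | _, _, .distant i j _ v => (braidMorphism [i, j] [j, i]).whiskerRight v
  | _, _, .adjacent i j _ v => (braidMorphism [i, j, i] [j, i, j]).whiskerRight v
  | _, _, .cons a m => m.morphism.whiskerLeft a

/-- The path morphism `f(p)` of a path `p` in the reduced expression graph: the composition of the
morphisms of its edges. -/
def pathMorphism {n : ℕ} {σ : Equiv.Perm (Fin (n + 1))} :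
    {v w : ReducedExpr σ} → (rexGraph σ).Walk v w → BSHom v.1 w.1
  | v, _, .nil => BSHom.id v.1
  | _, _, .cons h p => (pathMorphism p).comp (Classical.choice h).morphism

/-- The assertion of the Forking Path Conjecture for `σ`: any two paths in the reduced expression
graph of `σ` with the same endpoints, both passing through every vertex, have the same path
morphism. -/
def ForkingPathConjecture {n : ℕ} (σ : Equiv.Perm (Fin (n + 1))) : Prop :=
  ∀ (v w : ReducedExpr σ) (p q : (rexGraph σ).Walk v w),
    (∀ u, u ∈ p.support) → (∀ u, u ∈ q.support) → pathMorphism p = pathMorphism q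

end ForkingPath

end

noncomputable section

namespace ForkingPath

/-! Write `e` for a round trip along an adjacent edge, that is `f_{ji} f_{ij}` on `B_i B_j B_i`. A
distant round trip is the identity, because `B_i B_j` is generated by `1^⊗` as a bimodule.

Existence of `f_{ij}`: a map is built from iterated divided differences and dual bases of `R` over
the polynomials invariant under both `s_i` and `s_j`. Uniqueness in the adjacent case: `B_i B_j B_i`
is generated by `1^⊗` and `u = 1 ⊗ x_a ⊗ 1 ⊗ 1`, and a relation between these two generators fixes
the image of `u` after multiplication by `x_c ⊗ 1 - 1 ⊗ x_c` (outer slots). Evaluations at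
subexpressions show that this factor can be cancelled in the relevant degree
(`eq_zero_of_mul_eq_zero`, `IsBraidMorphism.map_innerVar`). Uniqueness gives `f_{ij} f_{ji} f_{ij} =
f_{ij}`, so `e` is idempotent.

For every element of `S_4` other than `12321` and `w_0` the graph of reduced expressions is a line.
Let `P_v` be the morphism of the walk from `v` to one end of the line and back, and `P'_v` the same
for the other end. If both families commute with all edge morphisms, then a path through both ends
satisfies `f(p) = P_w f(p) = f(p) P'_v P_v`; after `P'_v P_v` all backtracking disappears, so `f(p)`
depends only on the endpoints (`forkingPathConjecture_of_rootMaps`).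

Commutation only has to be checked between `P_v` and the round trip along the edge at `v` leading
away from the end. It is trivial unless two adjacent edges meet, which occurs only at the middle
word `i j i k i` of a five-vertex line. There the two idempotents overlap in one letter `i`, and
they commute by the explicit formula `adjacentProjector_apply`: the overlap sees only
`s_i`-invariant polynomials (`comp_comm_apply`). That the table of words is complete and consists of
lines is a finite computation. -/

/-! ### Divided differences -/

section DividedDifference

open MvPolynomial

variable {n : ℕ}

/-- The action of the simple reflection `s_i` on polynomials. -/
def reflect (i : Fin n) : Poly n →ₐ[ℝ] Poly n := rename (simpleRefl i)

theorem mem_invariants {i : Fin n} {p : Poly n} : p ∈ invariants i ↔ reflect i p = p := Iff.rfl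

theorem reflect_reflect (i : Fin n) (p : Poly n) : reflect i (reflect i p) = p := by
  have h : (simpleRefl i : Fin (n + 1) → Fin (n + 1)) ∘ simpleRefl i = _root_.id := by
    funext k; simp [simpleRefl]
  rw [reflect, rename_rename, h, rename_id_apply]

theorem reflect_coe {i : Fin n} (e : invariants i) : reflect i e = e := e.2

theorem reflect_X (i : Fin n) (k : Fin (n + 1)) : reflect i (X k) = X (simpleRefl i k) :=
  rename_X _ _

/-- `X_a - X_b` divides `f - s_i f` when `s_i` exchanges `a` and `b`. -/
theorem dvd_sub_reflect {i : Fin n} {a b : Fin (n + 1)} (h : simpleRefl i = Equiv.swap a b)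
    (f : Poly n) : (X a - X b : Poly n) ∣ f - reflect i f := by
  induction f using MvPolynomial.induction_on with
  | C r => simp [reflect]
  | add p q hp hq =>
    have := dvd_add hp hq
    rw [map_add]
    convert this using 1
    ring
  | mul_X p k hp =>
    have hk : (X a - X b : Poly n) ∣ X k - reflect i (X k) := by
      rw [reflect_X, h]
      rcases eq_or_ne k a with rfl | ha
      · simp
      rcases eq_or_ne k b with rfl | hb
      · rw [Equiv.swap_apply_right, ← neg_sub (X k) (X a), neg_dvd]
      · simp [Equiv.swap_apply_of_ne_of_ne ha hb]
    rw [map_mul]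
    -- Twisted Leibniz rule: `p x - s(p) s(x) = (p - s(p)) x + s(p) (x - s(x))`.
    have := dvd_add (hp.mul_right (X k)) (hk.mul_left (reflect i p))
    convert this using 1
    ring

theorem X_sub_X_ne_zero {a b : Fin (n + 1)} (h : a ≠ b) : (X a - X b : Poly n) ≠ 0 :=
  sub_ne_zero.2 fun e => h (X_injective e)

/-- `δ` is the divided difference `f ↦ (f - s_i f) / (X_a - X_b)`. -/
def IsDividedDifference {i : Fin n} (a b : Fin (n + 1)) (δ : Poly n →ₗ[invariants i] Poly n) :
    Prop :=
  a ≠ b ∧ simpleRefl i = Equiv.swap a b ∧ ∀ f, (X a - X b) * δ f = f - reflect i f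

theorem exists_isDividedDifference {i : Fin n} {a b : Fin (n + 1)} (hab : a ≠ b)
    (h : simpleRefl i = Equiv.swap a b) :
    ∃ δ : Poly n →ₗ[invariants i] Poly n, IsDividedDifference a b δ := by
  choose g hg using dvd_sub_reflect h
  have h0 := X_sub_X_ne_zero hab
  refine ⟨⟨⟨g, fun x y => ?_⟩, fun e x => ?_⟩, hab, h, fun f => (hg f).symm⟩
  · apply mul_left_cancel₀ h0
    rw [mul_add, ← hg, ← hg, ← hg, map_add]
    ring
  · apply mul_left_cancel₀ h0
    change (X a - X b) * g ((e : Poly n) * x) = (X a - X b) * ((e : Poly n) * g x)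
    rw [← hg, map_mul, reflect_coe, mul_left_comm, ← hg]
    ring

namespace IsDividedDifference

variable {i : Fin n} {a b : Fin (n + 1)} {δ : Poly n →ₗ[invariants i] Poly n}

theorem map_mul_of_mem (_hδ : IsDividedDifference a b δ) {e : Poly n} (he : e ∈ invariants i)
    (f : Poly n) : δ (e * f) = e * δ f :=
  δ.map_smul ⟨e, he⟩ f

theorem eq_of_mul_eq (hδ : IsDividedDifference a b δ) {f g : Poly n}
    (h : f - reflect i f = (X a - X b) * g) : δ f = g :=
  mul_left_cancel₀ (X_sub_X_ne_zero hδ.1) ((hδ.2.2 f).trans h)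

theorem map_of_mem (hδ : IsDividedDifference a b δ) {e : Poly n} (he : e ∈ invariants i) :
    δ e = 0 :=
  hδ.eq_of_mul_eq (by rw [mem_invariants.1 he]; ring)

theorem reflect_X_left (hδ : IsDividedDifference a b δ) : reflect i (X a) = X b := by
  rw [reflect_X, hδ.2.1, Equiv.swap_apply_left]

theorem reflect_X_right (hδ : IsDividedDifference a b δ) : reflect i (X b) = X a := by
  rw [reflect_X, hδ.2.1, Equiv.swap_apply_right]

theorem reflect_X_of_ne (hδ : IsDividedDifference a b δ) {c : Fin (n + 1)} (ha : c ≠ a)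
    (hb : c ≠ b) : reflect i (X c) = X c := by
  rw [reflect_X, hδ.2.1, Equiv.swap_apply_of_ne_of_ne ha hb]

theorem map_X_left (hδ : IsDividedDifference a b δ) : δ (X a) = 1 :=
  hδ.eq_of_mul_eq (by rw [hδ.reflect_X_left]; ring)

theorem map_X_right (hδ : IsDividedDifference a b δ) : δ (X b) = -1 :=
  hδ.eq_of_mul_eq (by rw [hδ.reflect_X_right]; ring)

/-- Divided differences take values in the invariants. -/
theorem map_mem (hδ : IsDividedDifference a b δ) (f : Poly n) : δ f ∈ invariants i := by
  rw [mem_invariants]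
  apply mul_left_cancel₀ (X_sub_X_ne_zero hδ.1)
  have h := congrArg (reflect i) (hδ.2.2 f)
  rw [map_mul, map_sub, map_sub, hδ.reflect_X_left, hδ.reflect_X_right, reflect_reflect] at h
  rw [hδ.2.2 f]
  linear_combination -h

/-- With `map_mem` this gives `f = (f - x_a δ f) + x_a δ f` with invariant coefficients, that is `R
= R^{s_i} + x_a R^{s_i}`. Every later normal form rests on this decomposition. -/
theorem sub_mul_mem (hδ : IsDividedDifference a b δ) (f : Poly n) :
    f - X a * δ f ∈ invariants i := by
  rw [mem_invariants, map_sub, map_mul, mem_invariants.1 (hδ.map_mem f), hδ.reflect_X_left]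
  linear_combination hδ.2.2 f

/-- Divided differences for the reversed order of the two variables. -/
theorem neg (hδ : IsDividedDifference a b δ) : IsDividedDifference b a (-δ) := by
  refine ⟨hδ.1.symm, by rw [hδ.2.1, Equiv.swap_comm], fun f => ?_⟩
  rw [LinearMap.neg_apply]
  linear_combination hδ.2.2 f

theorem map_isHomogeneous_zero (hδ : IsDividedDifference a b δ) {f : Poly n}
    (hf : f.IsHomogeneous 0) : δ f = 0 := by
  rw [← totalDegree_zero_iff_isHomogeneous, totalDegree_eq_zero_iff_eq_C] at hf
  refine hδ.map_of_mem ?_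
  rw [mem_invariants, hf]
  simp [reflect]

/-- Multiplication by the linear form `x_a - x_b` carries the component of `δ f` of degree `j` to
the component of `f - s_i f` of degree `j + 1`, which vanishes unless `j = k`. -/
theorem map_isHomogeneous (hδ : IsDividedDifference a b δ) {f : Poly n} {k : ℕ}
    (hf : f.IsHomogeneous (k + 1)) : (δ f).IsHomogeneous k := by
  have hs : (f - reflect i f).IsHomogeneous (k + 1) := hf.sub (hf.rename_isHomogeneous)
  have hX : (X a - X b : Poly n).IsHomogeneous 1 := (isHomogeneous_X ℝ a).sub (isHomogeneous_X ℝ b)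
  let _ : GradedAlgebra (homogeneousSubmodule (Fin (n + 1)) ℝ) := gradedAlgebra
  have hc : ∀ (x : Poly n) (j : ℕ), (DirectSum.decompose (homogeneousSubmodule (Fin (n + 1)) ℝ) x j
      : Poly n) = homogeneousComponent j x := fun x j => decomposition.decompose'_apply x j
  have hj : ∀ j, j ≠ k → homogeneousComponent j (δ f) = 0 := by
    intro j hjk
    apply mul_left_cancel₀ (X_sub_X_ne_zero hδ.1)
    have h := DirectSum.coe_decompose_mul_add_of_left_mem (homogeneousSubmodule (Fin (n + 1)) ℝ)
      (i := 1) (j := j) (a := X a - X b) (b := δ f) hX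
    rw [hδ.2.2, hc, hc] at h
    rw [← h, homogeneousComponent_of_mem hs, if_neg (by omega), mul_zero]
  rw [← sum_homogeneousComponent (δ f)]
  refine IsHomogeneous.sum _ _ _ fun j _ => ?_
  rcases eq_or_ne j k with rfl | h
  · exact homogeneousComponent_isHomogeneous _ _
  · rw [hj j h]; exact isHomogeneous_zero _ _ _

end IsDividedDifference

end DividedDifference

/-! ### Elements of Bott-Samelson bimodules -/

section Elements

variable {n : ℕ}

/-- The element `r ⊗ 1 ⊗ ⋯ ⊗ 1`. -/
def left (w : List (Fin n)) : Poly n →+* BS w := algebraMap (Poly n) (BS w)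

/-- The map `m ↦ 1 ⊗ m`. -/
def incl (i : Fin n) (w : List (Fin n)) : BS w →+* BS (i :: w) :=
  (Algebra.TensorProduct.includeRight (R := invariants i) (A := Poly n) (B := BS w)).toRingHom

theorem smul_eq_left_mul {w : List (Fin n)} (p : Poly n) (m : BS w) : p • m = left w p * m :=
  Algebra.smul_def p m

/-- Pure tensors become products in a commutative ring, so bimodule computations turn into ring
identities. -/
theorem tmul_eq (i : Fin n) (w : List (Fin n)) (p : Poly n) (m : BS w) :
    (p ⊗ₜ[invariants i] m : BS (i :: w)) = left (i :: w) p * incl i w m := by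
  change (p ⊗ₜ[invariants i] m : Poly n ⊗[invariants i] BS w) =
    (p ⊗ₜ[invariants i] (1 : BS w)) * ((1 : Poly n) ⊗ₜ[invariants i] m)
  rw [Algebra.TensorProduct.tmul_mul_tmul, mul_one, one_mul]

/-- An `s_i`-invariant crosses the tensor sign over `R^{s_i}`; this is the basic rule for moving
polynomials between slots. -/
theorem incl_left {i : Fin n} {w : List (Fin n)} {e : Poly n} (he : e ∈ invariants i) :
    incl i w (left w e) = left (i :: w) e :=
  RightBS.cons_algebraMap i w ⟨e, he⟩

theorem right_cons (i : Fin n) (w : List (Fin n)) (r : Poly n) :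
    right (i :: w) r = incl i w (right w r) := rfl

theorem induction_cons {i : Fin n} {w : List (Fin n)} {P : BS (i :: w) → Prop}
    (h1 : ∀ (p : Poly n) (m : BS w), P (left (i :: w) p * incl i w m))
    (h2 : ∀ s t, P s → P t → P (s + t)) (b : BS (i :: w)) : P b := by
  induction b using BS.cons_induction with
  | h0 => simpa using h1 0 0
  | h1 r m => rw [tmul_eq]; exact h1 r m
  | h2 s t hs ht => exact h2 s t hs ht

namespace BSHom

theorem ext_of_forall {w w' : List (Fin n)} {f g : BSHom w w'} (h : ∀ m, f m = g m) : f = g :=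
  BSHom.ext (funext h)

theorem map_left_mul {w w' : List (Fin n)} (f : BSHom w w') (p : Poly n) (m : BS w) :
    f (left w p * m) = left w' p * f m := by
  rw [← smul_eq_left_mul, ← smul_eq_left_mul]
  exact f.toLinearMap.map_smul p m

theorem map_mul_right {w w' : List (Fin n)} (f : BSHom w w') (m : BS w) (r : Poly n) :
    f (m * right w r) = f m * right w' r := f.map_right' m r

theorem map_add_apply {w w' : List (Fin n)} (f : BSHom w w') (s t : BS w) :
    f (s + t) = f s + f t := f.toLinearMap.map_add s t

theorem map_sub_apply {w w' : List (Fin n)} (f : BSHom w w') (s t : BS w) :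
    f (s - t) = f s - f t := f.toLinearMap.map_sub s t

theorem comp_apply {w w' w'' : List (Fin n)} (g : BSHom w' w'') (f : BSHom w w') (m : BS w) :
    g.comp f m = g (f m) := rfl

theorem id_apply {w : List (Fin n)} (m : BS w) : BSHom.id w m = m := rfl

theorem whiskerLeft_left_mul_incl (a : Fin n) {w w' : List (Fin n)} (f : BSHom w w') (p : Poly n)
    (m : BS w) : f.whiskerLeft a (left (a :: w) p * incl a w m) =
      left (a :: w') p * incl a w' (f m) := by
  rw [← tmul_eq, ← tmul_eq]
  exact whiskerLeft_apply a f p m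

theorem whiskerLeft_comp (a : Fin n) {w w' w'' : List (Fin n)} (g : BSHom w' w'')
    (f : BSHom w w') : (g.comp f).whiskerLeft a = (g.whiskerLeft a).comp (f.whiskerLeft a) :=
  ext_of_forall fun m => by
    induction m using induction_cons with
    | h1 p m => simp only [comp_apply, whiskerLeft_left_mul_incl]
    | h2 s t hs ht => rw [map_add_apply, map_add_apply, hs, ht]

theorem whiskerLeft_id (a : Fin n) (w : List (Fin n)) :
    (BSHom.id w).whiskerLeft a = BSHom.id (a :: w) :=
  ext_of_forall fun m => by
    induction m using induction_cons with
    | h1 p m => simp only [id_apply, whiskerLeft_left_mul_incl]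
    | h2 s t hs ht => rw [map_add_apply, map_add_apply, hs, ht]

end BSHom

theorem inl_cons (i : Fin n) (x v : List (Fin n)) (p : Poly n) (b : BS x) :
    inl (i :: x) v (left (i :: x) p * incl i x b) =
      left (i :: (x ++ v)) p * incl i (x ++ v) (inl x v b) := by
  rw [← tmul_eq, ← tmul_eq]
  exact Algebra.TensorProduct.map_tmul _ _ _ _

theorem inl_incl (i : Fin n) (x v : List (Fin n)) (b : BS x) :
    inl (i :: x) v (incl i x b) = incl i (x ++ v) (inl x v b) := by
  simpa using inl_cons i x v 1 b

theorem inl_left (x v : List (Fin n)) (p : Poly n) :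
    inl x v (left x p) = left (x ++ v) p := (inl x v).commutes p

theorem inr_cons (i : Fin n) (x v : List (Fin n)) (c : BS v) :
    inr (i :: x) v c = incl i (x ++ v) (inr x v c) := rfl

theorem induction_append {x v : List (Fin n)} {P : BS (x ++ v) → Prop}
    (h1 : ∀ (b : BS x) (c : BS v), P (inl x v b * inr x v c))
    (h2 : ∀ s t, P s → P t → P (s + t)) (m : BS (x ++ v)) : P m := by
  induction x with
  | nil =>
    have h := h1 1 m
    rw [map_one, one_mul] at h
    exact h
  | cons i x ih =>
    induction m using induction_cons (i := i) (w := x ++ v) with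
    | h1 p m =>
      -- The predicate passed to `ih` lives on the shorter bimodule, so the left coefficient has to
      -- stay quantified.
      revert p
      refine ih (P := fun m => ∀ p, P (left (i :: (x ++ v)) p * incl i (x ++ v) m)) ?_ ?_ m
      · intro b c p
        have := h1 (left (i :: x) p * incl i x b) c
        rw [inl_cons, inr_cons, mul_assoc, ← map_mul] at this
        exact this
      · intro s t hs ht p
        have := h2 _ _ (hs p) (ht p)
        rw [← mul_add, ← map_add] at this
        exact this
    | h2 s t hs ht => exact h2 s t hs ht

namespace BSHom

theorem whiskerRight_comp {x y z : List (Fin n)} (g : BSHom y z) (f : BSHom x y)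
    (v : List (Fin n)) :
    (g.comp f).whiskerRight v = (g.whiskerRight v).comp (f.whiskerRight v) :=
  ext_of_forall fun m => by
    induction m using induction_append with
    | h1 b c => simp only [comp_apply, whiskerRight_apply]
    | h2 s t hs ht => rw [map_add_apply, map_add_apply, hs, ht]

theorem whiskerRight_id (x v : List (Fin n)) :
    (BSHom.id x).whiskerRight v = BSHom.id (x ++ v) :=
  ext_of_forall fun m => by
    induction m using induction_append with
    | h1 b c => simp only [id_apply, whiskerRight_apply]
    | h2 s t hs ht => rw [map_add_apply, map_add_apply, hs, ht]

end BSHom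

end Elements

/-! ### The grading -/

section Grading

open MvPolynomial

variable {n : ℕ}

theorem mem_gradedPiece_of_eq {w : List (Fin n)} {d e : ℤ} (h : d = e) {m : BS w}
    (hm : m ∈ gradedPiece w d) : m ∈ gradedPiece w e := h ▸ hm

theorem mem_gradedPiece_nil {p : Poly n} {k : ℕ} (hp : p.IsHomogeneous k) :
    p ∈ gradedPiece ([] : List (Fin n)) (2 * k) :=
  AddSubgroup.subset_closure ⟨k, hp, rfl⟩

theorem gradedPiece_nil_le {d : ℤ} {H : AddSubgroup (Poly n)}
    (h : ∀ (k : ℕ) (p : Poly n), p.IsHomogeneous k → 2 * (k : ℤ) = d → p ∈ H) :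
    ∀ m ∈ gradedPiece ([] : List (Fin n)) d, m ∈ H := by
  have h1 : gradedPiece ([] : List (Fin n)) d ≤ H := by
    refine (AddSubgroup.closure_le _).2 ?_
    rintro p ⟨k, hp, hk⟩
    exact h k p hp hk
  exact fun m hm => h1 hm

theorem mem_gradedPiece_cons {i : Fin n} {w : List (Fin n)} {p : Poly n} {k : ℕ}
    (hp : p.IsHomogeneous k) {m : BS w} {e d : ℤ} (hm : m ∈ gradedPiece w e)
    (hd : 2 * (k : ℤ) - 1 + e = d) : left (i :: w) p * incl i w m ∈ gradedPiece (i :: w) d := by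
  rw [← tmul_eq]
  exact AddSubgroup.subset_closure ⟨k, e, p, m, hp, hm, hd, rfl⟩

theorem gradedPiece_cons_le {i : Fin n} {w : List (Fin n)} {d : ℤ} {H : AddSubgroup (BS (i :: w))}
    (h : ∀ (k : ℕ) (e : ℤ) (p : Poly n) (m : BS w), p.IsHomogeneous k → m ∈ gradedPiece w e →
      2 * (k : ℤ) - 1 + e = d → left (i :: w) p * incl i w m ∈ H) :
    ∀ m ∈ gradedPiece (i :: w) d, m ∈ H := by
  have h1 : gradedPiece (i :: w) d ≤ H := by
    refine (AddSubgroup.closure_le _).2 ?_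
    rintro _ ⟨k, e, p, m, hp, hm, hd, rfl⟩
    change (p ⊗ₜ[invariants i] m : BS (i :: w)) ∈ H
    rw [tmul_eq]
    exact h k e p m hp hm hd
  exact fun m hm => h1 hm

theorem one_mem_gradedPiece : ∀ w : List (Fin n), (1 : BS w) ∈ gradedPiece w (-w.length)
  | [] => mem_gradedPiece_of_eq (by simp) (mem_gradedPiece_nil (isHomogeneous_one (Fin (n + 1)) ℝ))
  | i :: w => by
    have h := mem_gradedPiece_cons (i := i) (isHomogeneous_one (Fin (n + 1)) ℝ)
      (one_mem_gradedPiece w) (d := -(i :: w).length) (by simp)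
    rwa [map_one, map_one, one_mul] at h

theorem left_mul_mem_gradedPiece {w : List (Fin n)} {p : Poly n} {k : ℕ}
    (hp : p.IsHomogeneous k) {d : ℤ} (m : BS w) (hm : m ∈ gradedPiece w d) :
    left w p * m ∈ gradedPiece w (2 * k + d) := by
  cases w with
  | nil =>
    refine gradedPiece_nil_le (H := (gradedPiece [] (2 * k + d)).comap
      (AddMonoidHom.mulLeft (left [] p))) ?_ m hm
    intro l q hq hl
    have := mem_gradedPiece_nil (hp.mul hq)
    rw [← hl]
    push_cast at this
    rw [mul_add] at this
    exact this
  | cons i w =>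
    refine gradedPiece_cons_le (H := (gradedPiece (i :: w) (2 * k + d)).comap
      (AddMonoidHom.mulLeft (left (i :: w) p))) ?_ m hm
    intro l e q m hq hm hl
    change left (i :: w) p * (left (i :: w) q * incl i w m) ∈ gradedPiece (i :: w) (2 * k + d)
    rw [← mul_assoc, ← map_mul]
    exact mem_gradedPiece_cons (hp.mul hq) hm (by push_cast; linarith)

theorem mul_right_mem_gradedPiece {r : Poly n} {k : ℕ} (hr : r.IsHomogeneous k) :
    ∀ (w : List (Fin n)) {d : ℤ} (m : BS w), m ∈ gradedPiece w d →
      m * right w r ∈ gradedPiece w (d + 2 * k)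
  | [], d, m, hm => by
    have := left_mul_mem_gradedPiece hr m hm
    rw [mul_comm m]
    exact mem_gradedPiece_of_eq (add_comm _ _) this
  | i :: w, d, m, hm => by
    refine gradedPiece_cons_le (H := (gradedPiece (i :: w) (d + 2 * k)).comap
      (AddMonoidHom.mulRight (right (i :: w) r))) ?_ m hm
    intro l e q m hq hm hl
    change left (i :: w) q * incl i w m * right (i :: w) r ∈ gradedPiece (i :: w) (d + 2 * k)
    rw [right_cons, mul_assoc, ← map_mul]
    exact mem_gradedPiece_cons hq (mul_right_mem_gradedPiece hr w m hm) (by linarith)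

/-- There are no elements of degree less than that of `1 ⊗ ⋯ ⊗ 1`. -/
theorem eq_zero_of_mem_gradedPiece : ∀ (w : List (Fin n)) {d : ℤ}, d < -w.length →
    ∀ m ∈ gradedPiece w d, m = 0
  | [], d, hd, m, hm => by
    refine gradedPiece_nil_le (H := ⊥) (fun k p _ hk => ?_) m hm
    simp at hd
    omega
  | i :: w, d, hd, m, hm => by
    refine gradedPiece_cons_le (H := ⊥) (fun k e p m _ hm hk => ?_) m hm
    rw [eq_zero_of_mem_gradedPiece w (by simp at hd; omega) m hm, map_zero, mul_zero]
    exact zero_mem _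

theorem isHomogeneous_zero_eq_C {p : Poly n} (hp : p.IsHomogeneous 0) : ∃ c : ℝ, p = C c :=
  ⟨_, totalDegree_eq_zero_iff_eq_C.1 ((totalDegree_zero_iff_isHomogeneous _).2 hp)⟩

theorem C_mem_invariants (i : Fin n) (c : ℝ) : (C c : Poly n) ∈ invariants i :=
  (invariants i).algebraMap_mem c

theorem incl_left_C (i : Fin n) (w : List (Fin n)) (c : ℝ) :
    incl i w (left w (C c)) = left (i :: w) (C c) := incl_left (C_mem_invariants i c)

/-- The elements of the degree of `1 ⊗ ⋯ ⊗ 1` are its multiples. -/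
theorem eq_C_of_mem_gradedPiece : ∀ (w : List (Fin n)) (m : BS w),
    m ∈ gradedPiece w (-w.length) → ∃ c : ℝ, m = left w (C c)
  | [], m, hm => by
    refine gradedPiece_nil_le (H := ((left []).comp (C (R := ℝ))).range.toAddSubgroup) ?_ m hm
      |>.imp fun c hc => hc.symm
    intro k p hp hk
    obtain rfl : k = 0 := by simp at hk; omega
    obtain ⟨c, rfl⟩ := isHomogeneous_zero_eq_C hp
    exact ⟨c, rfl⟩
  | i :: w, m, hm => by
    refine gradedPiece_cons_le (H := ((left (i :: w)).comp (C (R := ℝ))).range.toAddSubgroup) ?_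
      m hm |>.imp fun c hc => hc.symm
    intro k e p m hp hm hk
    rcases Nat.eq_zero_or_pos k with rfl | h
    · obtain rfl : e = -w.length := by simp at hk; omega
      obtain ⟨c, rfl⟩ := eq_C_of_mem_gradedPiece w m hm
      obtain ⟨c', rfl⟩ := isHomogeneous_zero_eq_C hp
      rw [incl_left_C, ← map_mul, ← map_mul]
      exact ⟨c' * c, rfl⟩
    · rw [eq_zero_of_mem_gradedPiece w (by simp at hk; omega) m hm, map_zero, mul_zero]
      exact zero_mem _

/-- A linear form in one of the slots of `1 ⊗ ⋯ ⊗ 1`. -/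
def linearElements : (w : List (Fin n)) → Set (BS w)
  | [] => {p : Poly n | p.IsHomogeneous 1}
  | i :: w => (left (i :: w) '' {p : Poly n | p.IsHomogeneous 1}) ∪ (incl i w '' linearElements w)

theorem C_mul_mem_linearElements (c : ℝ) : ∀ (w : List (Fin n)) (m : BS w),
    m ∈ linearElements w → left w (C c) * m ∈ linearElements w
  | [], m, hm => by
    have := (isHomogeneous_C (Fin (n + 1)) c).mul (n := 1) hm
    rwa [zero_add] at this
  | i :: w, m, hm => by
    rcases hm with ⟨p, hp, rfl⟩ | ⟨m, hm, rfl⟩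
    · refine Or.inl ⟨C c * p, ?_, map_mul _ _ _⟩
      have := (isHomogeneous_C (Fin (n + 1)) c).mul (n := 1) hp
      rwa [zero_add] at this
    · exact Or.inr ⟨_, C_mul_mem_linearElements c w m hm, by rw [map_mul, incl_left_C]⟩

/-- Two degrees above the bottom, the leftmost polynomial is a scalar, or it is linear and the
remaining factor is a scalar. If it has larger degree, the remaining factor lies below the bottom
degree and vanishes. -/
theorem gradedPiece_le_closure_linearElements : ∀ (w : List (Fin n)) (m : BS w),
    m ∈ gradedPiece w (-w.length + 2) → m ∈ AddSubgroup.closure (linearElements w)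
  | [], m, hm => by
    refine gradedPiece_nil_le (fun k p hp hk => ?_) m hm
    obtain rfl : k = 1 := by simp at hk; omega
    exact AddSubgroup.subset_closure hp
  | i :: w, m, hm => by
    refine gradedPiece_cons_le (fun k e p m hp hm hk => ?_) m hm
    obtain rfl | rfl | h : k = 0 ∨ k = 1 ∨ 2 ≤ k := by omega
    · obtain rfl : e = -w.length + 2 := by simp at hk; omega
      obtain ⟨c, rfl⟩ := isHomogeneous_zero_eq_C hp
      have h1 : AddSubgroup.closure (linearElements w) ≤
          (AddSubgroup.closure (linearElements (i :: w))).comap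
            ((AddMonoidHom.mulLeft (left (i :: w) (C c))).comp (incl i w).toAddMonoidHom) := by
        refine (AddSubgroup.closure_le _).2 fun m hm => AddSubgroup.subset_closure ?_
        exact C_mul_mem_linearElements c (i :: w) _ (Or.inr ⟨m, hm, rfl⟩)
      exact h1 (gradedPiece_le_closure_linearElements w m hm)
    · obtain rfl : e = -w.length := by simp at hk; omega
      obtain ⟨c, rfl⟩ := eq_C_of_mem_gradedPiece w m hm
      rw [incl_left_C, ← map_mul, mul_comm]
      refine AddSubgroup.subset_closure (Or.inl ⟨_, ?_, rfl⟩)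
      have := (isHomogeneous_C (Fin (n + 1)) c).mul (n := 1) hp
      rwa [zero_add] at this
    · rw [eq_zero_of_mem_gradedPiece w (by simp at hk; omega) m hm, map_zero, mul_zero]
      exact zero_mem _

end Grading

/-! ### The action of Bott-Samelson bimodules on polynomials by divided differences -/

section Act

open MvPolynomial

variable {n : ℕ}

/-- The operator `p_0 ∂_{i_1} p_1 ∂_{i_2} ⋯ ∂_{i_k} p_k` attached to `p_0 ⊗ p_1 ⊗ ⋯ ⊗ p_k`, where
`∂` is a family of operators linear over the invariants. -/
def act (δ : ∀ i : Fin n, Poly n →ₗ[invariants i] Poly n) :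
    (w : List (Fin n)) → Poly n → (BS w →ₗ[Poly n] Poly n)
  | [], y => LinearMap.toSpanSingleton (Poly n) (Poly n) y
  | i :: w, y => LinearMap.liftBaseChange (Poly n)
      ((δ i) ∘ₗ (act δ w y).restrictScalars (invariants i))

variable (δ : ∀ i : Fin n, Poly n →ₗ[invariants i] Poly n)

theorem act_left_mul (w : List (Fin n)) (y p : Poly n) (m : BS w) :
    act δ w y (left w p * m) = p * act δ w y m := by
  rw [← smul_eq_left_mul, map_smul, smul_eq_mul]

theorem act_left_mul_incl (i : Fin n) (w : List (Fin n)) (y p : Poly n) (m : BS w) :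
    act δ (i :: w) y (left (i :: w) p * incl i w m) = p * δ i (act δ w y m) := by
  rw [← tmul_eq]
  exact LinearMap.liftBaseChange_tmul _ _ _ _

theorem act_cons_one (i : Fin n) (w : List (Fin n)) (y : Poly n) :
    act δ (i :: w) y 1 = δ i (act δ w y 1) := by
  have := act_left_mul_incl δ i w y 1 1
  rwa [map_one, map_one, one_mul, one_mul] at this

/-- The right action is absorbed into the argument `y`, so right linearity of a map built from `act`
becomes a property of the family of arguments alone. -/
theorem act_mul_right (y r : Poly n) : ∀ (w : List (Fin n)) (m : BS w),
    act δ w y (m * right w r) = act δ w (r * y) m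
  | [], m => mul_assoc _ _ _
  | i :: w, m => by
    induction m using induction_cons with
    | h1 p m =>
      rw [right_cons, mul_assoc, ← map_mul, act_left_mul_incl, act_left_mul_incl,
        act_mul_right y r w]
    | h2 s t hs ht => rw [add_mul, map_add, map_add, hs, ht]

theorem act_add (y z : Poly n) : ∀ (w : List (Fin n)) (m : BS w),
    act δ w (y + z) m = act δ w y m + act δ w z m
  | [], m => mul_add _ _ _
  | i :: w, m => by
    induction m using induction_cons with
    | h1 p m => simp only [act_left_mul_incl, act_add y z w, map_add, mul_add]
    | h2 s t hs ht => rw [map_add, map_add, map_add, hs, ht]; ring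

theorem act_mul_of_mem (e y : Poly n) : ∀ (w : List (Fin n)), (∀ i ∈ w, e ∈ invariants i) →
    ∀ m : BS w, act δ w (e * y) m = e * act δ w y m
  | [], _, m => mul_left_comm _ _ _
  | i :: w, he, m => by
    induction m using induction_cons with
    | h1 p m =>
      have h : ∀ f, δ i (e * f) = e * δ i f := fun f => (δ i).map_smul ⟨e, he i (by simp)⟩ f
      rw [act_left_mul_incl, act_left_mul_incl,
        act_mul_of_mem e y w (fun j hj => he j (by simp [hj])), h, mul_left_comm]
    | h2 s t hs ht => rw [map_add, map_add, hs, ht, mul_add]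

/-- Each divided difference lowers the degree by `2`, while each letter had already lowered the
degree of the tensor by `1`; the net change is minus the length, plus `2k` from `y`. -/
theorem act_mem_gradedPiece {y : Poly n} {k : ℕ} (hy : y.IsHomogeneous k) :
    ∀ (w : List (Fin n)), (∀ i ∈ w, ∃ a b, IsDividedDifference a b (δ i)) → ∀ (d : ℤ) (m : BS w),
      m ∈ gradedPiece w d → (act δ w y m : BS ([] : List (Fin n))) ∈
        gradedPiece ([] : List (Fin n)) (d - w.length + 2 * k)
  | [], _, d, m, hm => by
    exact mem_gradedPiece_of_eq (by simp) (mul_right_mem_gradedPiece hy [] m hm)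
  | i :: w, hδ, d, m, hm => by
    obtain ⟨a, b, hi⟩ := hδ i (by simp)
    refine gradedPiece_cons_le (H := (gradedPiece ([] : List (Fin n))
      (d - (i :: w).length + 2 * k)).comap (act δ (i :: w) y).toAddMonoidHom) ?_ m hm
    intro l e p m hp hm hl
    change act δ (i :: w) y (left (i :: w) p * incl i w m) ∈
      gradedPiece ([] : List (Fin n)) (d - (i :: w).length + 2 * k)
    rw [act_left_mul_incl]
    have h1 := act_mem_gradedPiece hy w (fun j hj => hδ j (by simp [hj])) e m hm
    have h2 : ∀ d, ∀ q ∈ gradedPiece ([] : List (Fin n)) d,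
        (δ i q : BS ([] : List (Fin n))) ∈ gradedPiece ([] : List (Fin n)) (d - 2) := by
      intro d
      refine gradedPiece_nil_le (H := (gradedPiece ([] : List (Fin n))
        (d - 2)).comap (δ i).toAddMonoidHom) fun l q hq hl => ?_
      change δ i q ∈ gradedPiece ([] : List (Fin n)) (d - 2)
      cases l with
      | zero => rw [hi.map_isHomogeneous_zero hq]; exact zero_mem _
      | succ l =>
        refine mem_gradedPiece_of_eq ?_ (mem_gradedPiece_nil (hi.map_isHomogeneous hq))
        push_cast at hl
        linarith
    have h3 := left_mul_mem_gradedPiece hp _ (h2 _ _ h1)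
    refine mem_gradedPiece_of_eq ?_ h3
    simp
    linarith

theorem left_eq_right {e : Poly n} : ∀ (w : List (Fin n)), (∀ i ∈ w, e ∈ invariants i) →
    left w e = right w e
  | [], _ => rfl
  | i :: w, he => by
    rw [right_cons, ← left_eq_right w (fun j hj => he j (by simp [hj])),
      incl_left (he i (by simp))]

/-- The map `m ↦ ∑ act y m ⊗ 1 ⊗ ⋯ ⊗ 1 ⊗ z`, the sum being over the pairs `(y, z)` in a list. -/
def casimirFun (w w' : List (Fin n)) (c : List (Poly n × Poly n)) (m : BS w) : BS w' :=
  (c.map fun t => left w' (act δ w t.1 m) * right w' t.2).sum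

/-- The map `casimirFun` as a homomorphism of bimodules. -/
def casimirHom (w w' : List (Fin n)) (c : List (Poly n × Poly n))
    (h : ∀ k (m : BS w), casimirFun δ w w' c (m * right w (X k)) =
      casimirFun δ w w' c m * right w' (X k)) : BSHom w w' where
  toFun := casimirFun δ w w' c
  map_add' s t := by
    unfold casimirFun
    rw [← List.sum_map_add]
    simp only [map_add, add_mul]
  map_smul' r m := by
    simp only [casimirFun, smul_eq_left_mul, act_left_mul, map_mul, RingHom.id_apply,
      mul_assoc, List.sum_map_mul_left]
  map_right' m r := by
    have hadd : ∀ s t, casimirFun δ w w' c (s + t) =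
        casimirFun δ w w' c s + casimirFun δ w w' c t := by
      intro s t
      unfold casimirFun
      rw [← List.sum_map_add]
      simp only [map_add, add_mul]
    change casimirFun δ w w' c (m * right w r) = casimirFun δ w w' c m * right w' r
    -- Right linearity is assumed for variables only; scalars cross all tensor signs, and sums and
    -- products follow.
    induction r using MvPolynomial.induction_on generalizing m with
    | C a =>
      rw [← left_eq_right w fun i _ => C_mem_invariants i a,
        ← left_eq_right w' fun i _ => C_mem_invariants i a]
      simp only [casimirFun, mul_comm m, act_left_mul, map_mul, mul_assoc, List.sum_map_mul_left]
      rw [mul_comm]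
    | add p q hp hq => rw [map_add, mul_add, hadd, hp, hq, map_add, mul_add]
    | mul_X p k hp => rw [map_mul, ← mul_assoc, h, hp, map_mul, mul_assoc]

/-- Passing to polynomials shifts the degree by `-w.length + 2k`, the unit of the target by
`-w'.length`, the factor `z` by `2l`; the condition on `c` makes these cancel. -/
theorem casimirHom_isDegreeZero {w w' : List (Fin n)} {c : List (Poly n × Poly n)}
    (h : ∀ k (m : BS w), casimirFun δ w w' c (m * right w (X k)) =
      casimirFun δ w w' c m * right w' (X k))
    (hδ : ∀ i ∈ w, ∃ a b, IsDividedDifference a b (δ i))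
    (hc : ∀ t ∈ c, ∃ k l : ℕ, t.1.IsHomogeneous k ∧ t.2.IsHomogeneous l ∧
      2 * (k + l) = w.length + w'.length) :
    (casimirHom δ w w' c h).IsDegreeZero := by
  intro d m hm
  refine AddSubgroup.list_sum_mem _ fun x hx => ?_
  obtain ⟨t, ht, rfl⟩ := List.mem_map.1 hx
  obtain ⟨k, l, hk, hl, hkl⟩ := hc t ht
  have h1 := act_mem_gradedPiece δ hk w hδ d m hm
  have h2 : left w' (act δ w t.1 m) ∈ gradedPiece w' (d - w.length + 2 * k - w'.length) := by
    refine gradedPiece_nil_le (H := (gradedPiece w' (d - w.length + 2 * k - w'.length)).comap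
      (left w').toAddMonoidHom) (fun j p hp hj => ?_) _ h1
    have h3 := left_mul_mem_gradedPiece hp 1 (one_mem_gradedPiece w')
    rw [mul_one, hj, ← sub_eq_add_neg] at h3
    exact h3
  have h3 := mul_right_mem_gradedPiece hl w' _ h2
  refine mem_gradedPiece_of_eq ?_ h3
  omega

end Act

/-! ### Existence of braid morphisms -/

section Existence

open MvPolynomial

variable {n : ℕ}

theorem exists_standard_dividedDifferences (n : ℕ) :
    ∃ δ : ∀ i : Fin n, Poly n →ₗ[invariants i] Poly n,
      ∀ i, IsDividedDifference i.castSucc i.succ (δ i) := by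
  choose δ hδ using fun i : Fin n => exists_isDividedDifference (i := i) (a := i.castSucc)
    (b := i.succ) (Fin.castSucc_lt_succ).ne rfl
  exact ⟨δ, hδ⟩

theorem Adjacent.exists_dividedDifferences {i j : Fin n} (h : Adjacent i j) :
    ∃ (a b c : Fin (n + 1)) (δ : ∀ i : Fin n, Poly n →ₗ[invariants i] Poly n), a ≠ c ∧
      IsDividedDifference a b (δ i) ∧ IsDividedDifference b c (δ j) := by
  obtain ⟨δ, hδ⟩ := exists_standard_dividedDifferences n
  rcases h with h | h
  · have e : i.succ = j.castSucc := by ext; simpa using h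
    refine ⟨i.castSucc, i.succ, j.succ, δ, ?_, hδ i, e ▸ hδ j⟩
    intro e'
    have := congrArg Fin.val e'
    simp at this
    omega
  · have e : j.succ = i.castSucc := by ext; simpa using h
    -- When `j = i - 1` the three variables are read backwards, which changes the sign of the
    -- divided differences. Both orders then fit the pattern `s_i = (a b)`, `s_j = (b c)`.
    refine ⟨i.succ, i.castSucc, j.castSucc, fun k => -δ k, ?_, (hδ i).neg, e ▸ (hδ j).neg⟩
    intro e'
    have := congrArg Fin.val e'
    simp at this
    omega

theorem Distant.exists_dividedDifferences {i j : Fin n} (h : Distant i j) :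
    ∃ (a b c d : Fin (n + 1)) (δ : ∀ i : Fin n, Poly n →ₗ[invariants i] Poly n),
      (a ≠ c ∧ a ≠ d ∧ b ≠ c ∧ b ≠ d) ∧
      IsDividedDifference a b (δ i) ∧ IsDividedDifference c d (δ j) := by
  obtain ⟨δ, hδ⟩ := exists_standard_dividedDifferences n
  refine ⟨i.castSucc, i.succ, j.castSucc, j.succ, δ, ?_, hδ i, hδ j⟩
  refine ⟨?_, ?_, ?_, ?_⟩ <;>
  · intro e'
    have := congrArg Fin.val e'
    simp at this
    rcases h with h | h <;> omega

theorem act_nil_one (δ : ∀ i : Fin n, Poly n →ₗ[invariants i] Poly n) (y : Poly n) :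
    act δ [] y 1 = y := one_mul y

/-- Dual bases of `R` over the invariants of two commuting simple reflections. -/
def distantCasimir (a b c d : Fin (n + 1)) : List (Poly n × Poly n) :=
  [(X a * X c, 1), (X a, -X d), (X c, -X b), (1, X b * X d)]

/-- The list is the expansion of `(x_a ⊗ 1 - 1 ⊗ x_b)(x_c ⊗ 1 - 1 ⊗ x_d)`, on which the left and
right multiplications by any variable agree modulo the common invariants. For `x_a` and `x_b` this
uses that they are roots of `t^2 - (x_a + x_b) t + x_a x_b`, likewise for `x_c` and `x_d`; the other
variables are invariant. The maps `L` and `ρ` stand for the two tensor factors. -/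
theorem distantCasimir_mul {i j : Fin n} {a b c d : Fin (n + 1)}
    {δ : Poly n →ₗ[invariants i] Poly n} {δ' : Poly n →ₗ[invariants j] Poly n}
    (hd : a ≠ c ∧ a ≠ d ∧ b ≠ c ∧ b ≠ d) (hi : IsDividedDifference a b δ)
    (hj : IsDividedDifference c d δ') {N : Type*} [CommRing N] (L : Poly n →+ N)
    (ρ : Poly n →+* N)
    (hL : ∀ e ∈ invariants i, e ∈ invariants j → ∀ y, L (e * y) = ρ e * L y) (k : Fin (n + 1)) :
    ((distantCasimir a b c d).map fun t => L (X k * t.1) * ρ t.2).sum =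
      ((distantCasimir a b c d).map fun t => L t.1 * ρ t.2).sum * ρ (X k) := by
  obtain ⟨hac, had, hbc, hbd⟩ := hd
  have s1 := hi.reflect_X_left
  have s2 := hi.reflect_X_right
  have s3 := hi.reflect_X_of_ne hac.symm hbc.symm
  have s4 := hi.reflect_X_of_ne had.symm hbd.symm
  have t1 := hj.reflect_X_left
  have t2 := hj.reflect_X_right
  have t3 := hj.reflect_X_of_ne hac had
  have t4 := hj.reflect_X_of_ne hbc hbd
  have a1 := hL (X a + X b) (by rw [mem_invariants, map_add, s1, s2, add_comm])
    (by rw [mem_invariants, map_add, t3, t4])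
  have a2 := hL (X a * X b) (by rw [mem_invariants, map_mul, s1, s2, mul_comm])
    (by rw [mem_invariants, map_mul, t3, t4])
  have b1 := hL (X c + X d) (by rw [mem_invariants, map_add, s3, s4])
    (by rw [mem_invariants, map_add, t1, t2, add_comm])
  have b2 := hL (X c * X d) (by rw [mem_invariants, map_mul, s3, s4])
    (by rw [mem_invariants, map_mul, t1, t2, mul_comm])
  simp only [map_add, map_mul] at a1 a2 b1 b2
  have ha : ∀ y, L (X a * (X a * y)) = (ρ (X a) + ρ (X b)) * L (X a * y) -
      ρ (X a) * ρ (X b) * L y := fun y => by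
    rw [← a1, ← a2, ← map_sub]; congr 1; ring
  have hb : ∀ y, L (X b * y) = (ρ (X a) + ρ (X b)) * L y - L (X a * y) := fun y => by
    rw [← a1, ← map_sub]; congr 1; ring
  have hc : ∀ y, L (X c * (X c * y)) = (ρ (X c) + ρ (X d)) * L (X c * y) -
      ρ (X c) * ρ (X d) * L y := fun y => by
    rw [← b1, ← b2, ← map_sub]; congr 1; ring
  have hd : ∀ y, L (X d * y) = (ρ (X c) + ρ (X d)) * L y - L (X c * y) := fun y => by
    rw [← b1, ← map_sub]; congr 1; ring
  simp only [distantCasimir, List.map_cons, List.map_nil, List.sum_cons, List.sum_nil, map_neg,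
    map_mul, map_one]
  have ha1 := ha 1
  have hc1 := hc 1
  have haC := ha (X c)
  have hcA := hc (X a)
  have hb1 := hb 1
  have hd1 := hd 1
  have p1 : L (X c * X a) = L (X a * X c) := by rw [mul_comm]
  have p2 : L (X c * (X a * X c)) = L (X c * (X c * X a)) := by rw [mul_comm (X a)]
  simp only [mul_one] at ha1 hc1 hb1 hd1 ⊢
  rw [p1] at hcA
  by_cases hka : k = a
  · subst hka
    linear_combination haC - ρ (X d) * ha1
  by_cases hkb : k = b
  · subst hkb
    linear_combination hb (X a * X c) - ρ (X d) * hb (X a) - ρ (X k) * hb (X c) +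
      ρ (X k) * ρ (X d) * hb1 - haC + ρ (X d) * ha1
  by_cases hkc : k = c
  · subst hkc
    linear_combination p2 - ρ (X d) * p1 + hcA - ρ (X b) * hc1
  by_cases hkd : k = d
  · subst hkd
    linear_combination hd (X a * X c) - ρ (X k) * hd (X a) - ρ (X b) * hd (X c) +
      ρ (X b) * ρ (X k) * hd1 - p2 + ρ (X k) * p1 - hcA + ρ (X b) * hc1
  · have h := hL (X k) (hi.reflect_X_of_ne hka hkb) (hj.reflect_X_of_ne hkc hkd)
    have h1 := h 1
    rw [mul_one] at h1
    rw [h, h, h, h1]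
    ring

/-- Dual bases of `R` over the invariants of two adjacent simple reflections. -/
def adjacentCasimir (a b c : Fin (n + 1)) : List (Poly n × Poly n) :=
  [(X a ^ 2 * X b, 1), (X a ^ 2, -X c), (X a * X b, -(X b + X c)), (X a, (X b + X c) * X c),
    (X b, X b * X c), (1, -(X b * X c ^ 2))]

theorem adjacent_invariants {i j : Fin n} {a b c : Fin (n + 1)}
    {δ : Poly n →ₗ[invariants i] Poly n} {δ' : Poly n →ₗ[invariants j] Poly n}
    (hac : a ≠ c) (hi : IsDividedDifference a b δ) (hj : IsDividedDifference b c δ') :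
    ((X a + X b + X c : Poly n) ∈ invariants i ∧ (X a + X b + X c : Poly n) ∈ invariants j) ∧
    ((X a * X b + X a * X c + X b * X c : Poly n) ∈ invariants i ∧
      (X a * X b + X a * X c + X b * X c : Poly n) ∈ invariants j) ∧
    ((X a * X b * X c : Poly n) ∈ invariants i ∧ (X a * X b * X c : Poly n) ∈ invariants j) := by
  have s1 := hi.reflect_X_left
  have s2 := hi.reflect_X_right
  have s3 := hi.reflect_X_of_ne hac.symm hj.1.symm
  have t1 := hj.reflect_X_left
  have t2 := hj.reflect_X_right
  have t3 := hj.reflect_X_of_ne hi.1 hac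
  simp only [mem_invariants, map_add, map_mul, s1, s2, s3, t1, t2, t3]
  refine ⟨⟨?_, ?_⟩, ⟨?_, ?_⟩, ?_, ?_⟩ <;> ring

/-- Here the list expands `(x_a ⊗ 1 - 1 ⊗ x_b)(x_a ⊗ 1 - 1 ⊗ x_c)(x_b ⊗ 1 - 1 ⊗ x_c)`, whose left
factors are the monomials `x_a^r x_b^s` with `r ≤ 2`, `s ≤ 1`. -/
theorem adjacentCasimir_mul {i j : Fin n} {a b c : Fin (n + 1)}
    {δ : Poly n →ₗ[invariants i] Poly n} {δ' : Poly n →ₗ[invariants j] Poly n}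
    (hac : a ≠ c) (hi : IsDividedDifference a b δ)
    (hj : IsDividedDifference b c δ') {N : Type*} [CommRing N] (L : Poly n →+ N)
    (ρ : Poly n →+* N)
    (hL : ∀ e ∈ invariants i, e ∈ invariants j → ∀ y, L (e * y) = ρ e * L y) (k : Fin (n + 1)) :
    ((adjacentCasimir a b c).map fun t => L (X k * t.1) * ρ t.2).sum =
      ((adjacentCasimir a b c).map fun t => L t.1 * ρ t.2).sum * ρ (X k) := by
  obtain ⟨⟨i1, j1⟩, ⟨i2, j2⟩, i3, j3⟩ := adjacent_invariants hac hi hj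
  have h1 := hL _ i1 j1
  have h2 := hL _ i2 j2
  have h3 := hL _ i3 j3
  -- The rules `r1` to `r6` rewrite products with a variable in terms of the six monomials, with
  -- coefficients the elementary symmetric polynomials in the three variables.
  have r1 : L (X a * (X a ^ 2 * X b)) = ρ (X a + X b + X c) * L (X a ^ 2 * X b) -
      ρ (X a * X b + X a * X c + X b * X c) * L (X a * X b) + ρ (X a * X b * X c) * L (X b) := by
    rw [← h1, ← h2, ← h3, ← map_sub, ← map_add]; congr 1; ring
  have r2 : L (X a * X a ^ 2) = ρ (X a + X b + X c) * L (X a ^ 2) -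
      ρ (X a * X b + X a * X c + X b * X c) * L (X a) + ρ (X a * X b * X c) * L 1 := by
    rw [← h1, ← h2, ← h3, ← map_sub, ← map_add]; congr 1; ring
  have r3 : L (X b * X b) = ρ (X a + X b + X c) * (L (X a) + L (X b)) -
      ρ (X a * X b + X a * X c + X b * X c) * L 1 - L (X a ^ 2) - L (X a * X b) := by
    rw [← map_add, ← h1, ← h2, ← map_sub, ← map_sub, ← map_sub]; congr 1; ring
  have r4 : L (X b * (X a * X b)) = ρ (X a + X b + X c) * L (X a * X b) -
      ρ (X a * X b * X c) * L 1 - L (X a ^ 2 * X b) := by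
    rw [← h1, ← h3, ← map_sub, ← map_sub]; congr 1; ring
  have r5 : L (X b * (X a ^ 2 * X b)) = ρ (X a * X b + X a * X c + X b * X c) * L (X a * X b) -
      ρ (X a * X b * X c) * (L (X a) + L (X b)) := by
    rw [← map_add, ← h2, ← h3, ← map_sub]; congr 1; ring
  have r6 : ∀ y, L (X c * y) = ρ (X a + X b + X c) * L y - L (X a * y) - L (X b * y) := by
    intro y
    rw [← h1, ← map_sub, ← map_sub]; congr 1; ring
  have p1 : (X b * X a ^ 2 : Poly n) = X a ^ 2 * X b := by ring
  have p2 : (X b * X a : Poly n) = X a * X b := by ring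
  have p3 : (X a * (X a * X b) : Poly n) = X a ^ 2 * X b := by ring
  have p4 : (X a * X a : Poly n) = X a ^ 2 := by ring
  simp only [adjacentCasimir, List.map_cons, List.map_nil, List.sum_cons, List.sum_nil, mul_one]
  by_cases hka : k = a
  · subst hka
    rw [r1, r2, p3, p4]
    simp only [map_neg, map_mul, map_one, map_add, map_pow]
    ring
  by_cases hkb : k = b
  · subst hkb
    rw [r3, r4, r5, p1, p2]
    simp only [map_neg, map_mul, map_one, map_add, map_pow]
    ring
  by_cases hkc : k = c
  · subst hkc
    have r7 := r6 1
    rw [mul_one, mul_one, mul_one] at r7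
    rw [r6, r6, r6, r6, r6, r7, r1, r2, r3, r4, r5, p1, p2, p3, p4]
    simp only [map_neg, map_mul, map_one, map_add, map_pow]
    ring
  · have h := hL (X k) (hi.reflect_X_of_ne hka hkb) (hj.reflect_X_of_ne hkb hkc)
    have h' := h 1
    rw [mul_one] at h'
    rw [h, h, h, h, h, h']
    ring

/-- The abstract Casimir identity is applied to `L y = left (act y m)`, which is linear over the
common invariants because these cross every divided difference and every tensor sign. -/
theorem casimirFun_mul_right_X (δ : ∀ i : Fin n, Poly n →ₗ[invariants i] Poly n)
    {w w' : List (Fin n)} {c : List (Poly n × Poly n)}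
    (h : ∀ (L : Poly n →+ BS w'), (∀ e, (∀ i ∈ w ++ w', e ∈ invariants i) →
      ∀ y, L (e * y) = right w' e * L y) → ∀ k, (c.map fun t => L (X k * t.1) * right w' t.2).sum =
        (c.map fun t => L t.1 * right w' t.2).sum * right w' (X k)) (k : Fin (n + 1)) (m : BS w) :
    casimirFun δ w w' c (m * right w (X k)) = casimirFun δ w w' c m * right w' (X k) := by
  have h0 : act δ w 0 m = 0 := by simpa using act_add δ 0 0 w m
  have := h ⟨⟨fun y => left w' (act δ w y m), by
    rw [h0, map_zero]⟩, fun y z => by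
    simp only [act_add, map_add]⟩ (fun e he y => ?_) k
  · simp only [casimirFun, act_mul_right]
    exact this
  · change left w' (act δ w (e * y) m) = right w' e * left w' (act δ w y m)
    rw [act_mul_of_mem δ e y w fun i hi => he i (by simp [hi]), map_mul,
      left_eq_right w' fun i hi => he i (by simp [hi])]

theorem Distant.exists_isBraidMorphism {i j : Fin n} (h : Distant i j) :
    ∃ f : BSHom [i, j] [j, i], IsBraidMorphism f := by
  obtain ⟨a, b, c, d, δ, hd, hi, hj⟩ := h.exists_dividedDifferences
  have hX : ∀ k (m : BS [i, j]), casimirFun δ [i, j] [j, i] (distantCasimir a b c d)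
      (m * right [i, j] (X k)) = casimirFun δ [i, j] [j, i] (distantCasimir a b c d) m *
        right [j, i] (X k) :=
    casimirFun_mul_right_X δ fun L hL => distantCasimir_mul hd hi hj L (right [j, i])
      fun e he he' => hL e (by simp [he, he'])
  refine ⟨casimirHom δ _ _ _ hX, casimirHom_isDegreeZero δ hX ?_ ?_, ?_⟩
  · intro k hk
    simp only [List.mem_cons, List.not_mem_nil, or_false] at hk
    rcases hk with rfl | rfl
    exacts [⟨a, b, hi⟩, ⟨c, d, hj⟩]
  · intro t ht
    have h1 : ∀ k, (X k : Poly n).IsHomogeneous 1 := fun k => isHomogeneous_X ℝ k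
    have h0 := isHomogeneous_one (Fin (n + 1)) ℝ
    simp only [distantCasimir, List.mem_cons, List.not_mem_nil, or_false] at ht
    rcases ht with rfl | rfl | rfl | rfl
    exacts [⟨2, 0, (h1 a).mul (h1 c), h0, rfl⟩, ⟨1, 1, h1 a, (h1 d).neg, rfl⟩,
      ⟨1, 1, h1 c, (h1 b).neg, rfl⟩, ⟨0, 2, h0, (h1 b).mul (h1 d), rfl⟩]
  · change casimirFun δ [i, j] [j, i] (distantCasimir a b c d) 1 = 1
    obtain ⟨hac, had, hbc, hbd⟩ := hd
    have t3 : (X a : Poly n) ∈ invariants j := hj.reflect_X_of_ne hac had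
    have t : ∀ {k : Fin n}, (1 : Poly n) ∈ invariants k := one_mem _
    have e1 : δ j (X a * X c) = X a := by rw [hj.map_mul_of_mem t3, hj.map_X_left, mul_one]
    -- Only the top term `x_a x_c` survives two divided differences, with value `1`.
    simp only [casimirFun, distantCasimir, List.map_cons, List.map_nil, List.sum_cons,
      List.sum_nil, act_cons_one, act_nil_one, e1, hi.map_X_left, hj.map_X_left, hj.map_of_mem t3,
      hj.map_of_mem t, hi.map_of_mem t, map_zero, map_one]
    ring

theorem Adjacent.exists_isBraidMorphism {i j : Fin n} (h : Adjacent i j) :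
    ∃ f : BSHom [i, j, i] [j, i, j], IsBraidMorphism f := by
  obtain ⟨a, b, c, δ, hac, hi, hj⟩ := h.exists_dividedDifferences
  have hX : ∀ k (m : BS [i, j, i]), casimirFun δ [i, j, i] [j, i, j] (adjacentCasimir a b c)
      (m * right [i, j, i] (X k)) = casimirFun δ [i, j, i] [j, i, j] (adjacentCasimir a b c) m *
        right [j, i, j] (X k) :=
    casimirFun_mul_right_X δ fun L hL => adjacentCasimir_mul hac hi hj L (right [j, i, j])
      fun e he he' => hL e (by simp [he, he'])
  refine ⟨casimirHom δ _ _ _ hX, casimirHom_isDegreeZero δ hX ?_ ?_, ?_⟩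
  · intro k hk
    simp only [List.mem_cons, List.not_mem_nil, or_false] at hk
    rcases hk with rfl | rfl | rfl
    exacts [⟨a, b, hi⟩, ⟨b, c, hj⟩, ⟨a, b, hi⟩]
  · intro t ht
    have h1 : ∀ k, (X k : Poly n).IsHomogeneous 1 := fun k => isHomogeneous_X ℝ k
    have h2 : ∀ k, (X k ^ 2 : Poly n).IsHomogeneous 2 := fun k => isHomogeneous_X_pow k 2
    have h0 := isHomogeneous_one (Fin (n + 1)) ℝ
    simp only [adjacentCasimir, List.mem_cons, List.not_mem_nil, or_false] at ht
    rcases ht with rfl | rfl | rfl | rfl | rfl | rfl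
    exacts [⟨3, 0, (h2 a).mul (h1 b), h0, rfl⟩, ⟨2, 1, h2 a, (h1 c).neg, rfl⟩,
      ⟨2, 1, (h1 a).mul (h1 b), ((h1 b).add (h1 c)).neg, rfl⟩,
      ⟨1, 2, h1 a, ((h1 b).add (h1 c)).mul (h1 c), rfl⟩, ⟨1, 2, h1 b, (h1 b).mul (h1 c), rfl⟩,
      ⟨0, 3, h0, ((h1 b).mul (h2 c)).neg, rfl⟩]
  · change casimirFun δ [i, j, i] [j, i, j] (adjacentCasimir a b c) 1 = 1
    have t3 : (X a : Poly n) ∈ invariants j := hj.reflect_X_of_ne hi.1 hac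
    have t : ∀ {k : Fin n}, (1 : Poly n) ∈ invariants k := one_mem _
    have s1 : (X a + X b : Poly n) ∈ invariants i := by
      rw [mem_invariants, map_add, hi.reflect_X_left, hi.reflect_X_right, add_comm]
    have s2 : (X a * X b : Poly n) ∈ invariants i := by
      rw [mem_invariants, map_mul, hi.reflect_X_left, hi.reflect_X_right, mul_comm]
    have e1 : δ i (X a ^ 2 * X b) = X a * X b := by
      rw [show (X a ^ 2 * X b : Poly n) = X a * X b * X a by ring, hi.map_mul_of_mem s2,
        hi.map_X_left, mul_one]
    have e2 : δ i (X a ^ 2) = X a + X b := by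
      rw [show (X a ^ 2 : Poly n) = (X a + X b) * X a - X a * X b by ring, map_sub,
        hi.map_mul_of_mem s1, hi.map_X_left, hi.map_of_mem s2, mul_one, sub_zero]
    have e3 : δ j (X a * X b) = X a := by rw [hj.map_mul_of_mem t3, hj.map_X_left, mul_one]
    have e4 : δ j (X a + X b) = 1 := by rw [map_add, hj.map_of_mem t3, hj.map_X_left, zero_add]
    -- Again only the top term survives: `x_a^2 x_b` goes to `x_a x_b`, then `x_a`, then `1`.
    simp only [casimirFun, adjacentCasimir, List.map_cons, List.map_nil, List.sum_cons,
      List.sum_nil, act_cons_one, act_nil_one, e1, e2, e3, e4, hi.map_X_left, hi.map_X_right,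
      map_neg, hi.map_of_mem s2, hj.map_of_mem t, hi.map_of_mem t, map_zero, map_one]
    ring

end Existence

/-! ### Uniqueness of braid morphisms -/

section Uniqueness

open MvPolynomial

variable {n : ℕ}

theorem exists_left_nil (m : BS ([] : List (Fin n))) : ∃ r : Poly n, m = left [] r := ⟨m, rfl⟩

/-- As a bimodule, `B_i B_j` is generated by `1 ⊗ 1 ⊗ 1` when `i`, `j` are distant. -/
theorem Distant.induction {i j : Fin n} (h : Distant i j) {P : BS [i, j] → Prop}
    (h1 : ∀ p r : Poly n, P (left [i, j] p * right [i, j] r))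
    (h2 : ∀ s t, P s → P t → P (s + t)) (m : BS [i, j]) : P m := by
  obtain ⟨a, b, c, d, δ, hd, hi, hj⟩ := h.exists_dividedDifferences
  induction m using induction_cons with
  | h1 p m =>
    induction m using induction_cons with
    | h1 q m =>
      obtain ⟨s, hs⟩ := exists_left_nil m
      rw [hs]
      -- The middle polynomial is `q' + x_a δ q` with `q'` and `δ q` invariant under `s_i`. These
      -- move to the left end, and the `s_j`-invariant `x_a` moves to the right end.
      have ha : (X a : Poly n) ∈ invariants j := hj.reflect_X_of_ne hd.1 hd.2.1
      have e1 : incl i [j] (left [j] (q - X a * δ i q)) = left [i, j] (q - X a * δ i q) :=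
        incl_left (hi.sub_mul_mem q)
      have e2 : incl i [j] (left [j] (δ i q)) = left [i, j] (δ i q) := incl_left (hi.map_mem q)
      have e3 : incl i [j] (left [j] (X a)) = right [i, j] (X a) := by
        rw [← incl_left ha]; rfl
      have e4 : incl i [j] (incl j [] (left [] s)) = right [i, j] s := rfl
      have e : left [i, j] p * incl i [j] (left [j] q * incl j [] (left [] s)) =
          left [i, j] (p * (q - X a * δ i q)) * right [i, j] s +
            left [i, j] (p * δ i q) * right [i, j] (X a * s) := by
        rw [show left [j] q = left [j] (q - X a * δ i q) + left [j] (X a) * left [j] (δ i q) by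
          rw [← map_mul, ← map_add]; congr 1; ring]
        simp only [map_mul, map_add, e1, e2, e3, e4]
        ring
      rw [e]
      exact h2 _ _ (h1 _ _) (h1 _ _)
    | h2 s t hs ht => rw [map_add, mul_add]; exact h2 _ _ hs ht
  | h2 s t hs ht => exact h2 _ _ hs ht

theorem BSHom.map_left_mul_right {w w' : List (Fin n)} (f : BSHom w w') (p r : Poly n) :
    f (left w p * right w r) = left w' p * (f 1 * right w' r) := by
  rw [f.map_left_mul, ← one_mul (right w r), f.map_mul_right]

theorem BSHom.map_left_mul_mul_right {w w' : List (Fin n)} (f : BSHom w w') (p r : Poly n)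
    (m : BS w) : f (left w p * m * right w r) = left w' p * f m * right w' r := by
  rw [f.map_mul_right, f.map_left_mul]

theorem Distant.hom_ext {i j : Fin n} (h : Distant i j) {w : List (Fin n)} {f g : BSHom [i, j] w}
    (h1 : f 1 = g 1) : f = g :=
  BSHom.ext_of_forall fun m => by
    induction m using h.induction with
    | h1 p r => rw [f.map_left_mul_right, g.map_left_mul_right, h1]
    | h2 s t hs ht => rw [f.map_add_apply, g.map_add_apply, hs, ht]

theorem Distant.existsUnique {i j : Fin n} (h : Distant i j) :
    ∃! f : BSHom [i, j] [j, i], IsBraidMorphism f := by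
  obtain ⟨f, hf⟩ := h.exists_isBraidMorphism
  exact ⟨f, hf, fun g hg => h.hom_ext (hg.2.trans hf.2.symm)⟩

/-- The element `1 ⊗ x_k ⊗ 1 ⊗ 1`. -/
def innerVar (i j : Fin n) (v : List (Fin n)) (k : Fin (n + 1)) : BS (i :: j :: v) :=
  incl i (j :: v) (left (j :: v) (X k))

/-! ### Generators and relations of `B_i B_j B_i` for adjacent `i`, `j` -/

section Adjacent

variable {i j : Fin n} {a b c : Fin (n + 1)} {δ : Poly n →ₗ[invariants i] Poly n}
  {δ' : Poly n →ₗ[invariants j] Poly n}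

theorem IsDividedDifference.add_mem (hi : IsDividedDifference a b δ) :
    (X a + X b : Poly n) ∈ invariants i := by
  rw [mem_invariants, map_add, hi.reflect_X_left, hi.reflect_X_right, add_comm]

theorem IsDividedDifference.mul_mem (hi : IsDividedDifference a b δ) :
    (X a * X b : Poly n) ∈ invariants i := by
  rw [mem_invariants, map_mul, hi.reflect_X_left, hi.reflect_X_right, mul_comm]

theorem IsDividedDifference.mem_of_ne (hi : IsDividedDifference a b δ) (hca : c ≠ a)
    (hcb : c ≠ b) : (X c : Poly n) ∈ invariants i :=
  hi.reflect_X_of_ne hca hcb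

theorem IsDividedDifference.left_eq (_hi : IsDividedDifference a b δ) (w : List (Fin n))
    (q : Poly n) : left w q = left w (q - X a * δ q) + left w (X a) * left w (δ q) := by
  rw [← map_mul, ← map_add]; congr 1; ring

/-- `1 ⊗ q ⊗ m` in terms of `1 ⊗ 1 ⊗ m` and `1 ⊗ x_a ⊗ m`. -/
theorem incl_left_eq (hi : IsDividedDifference a b δ) (v : List (Fin n)) (q : Poly n) :
    incl i (j :: v) (left (j :: v) q) =
      left (i :: j :: v) (q - X a * δ q) + innerVar i j v a * left (i :: j :: v) (δ q) := by
  rw [hi.left_eq, map_add, map_mul, incl_left (hi.sub_mul_mem q), incl_left (hi.map_mem q)]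
  rfl

/-- The variable `x_a` is fixed by `s_j`, hence the two middle slots share it; one extra generator
therefore suffices for both. -/
theorem incl_incl_left (hac : a ≠ c) (hi : IsDividedDifference a b δ)
    (hj : IsDividedDifference b c δ') (v : List (Fin n)) :
    incl i (j :: v) (incl j v (left v (X a))) = innerVar i j v a := by
  rw [incl_left (hj.mem_of_ne hi.1 hac), innerVar]

/-- `1 ⊗ 1 ⊗ r ⊗ m` in terms of `1 ⊗ 1 ⊗ 1 ⊗ m` and `1 ⊗ x_a ⊗ 1 ⊗ m`. -/
theorem incl_incl_left_eq (hac : a ≠ c) (hi : IsDividedDifference a b δ)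
    (hj : IsDividedDifference b c δ') (v : List (Fin n)) (r : Poly n) :
    incl i (j :: i :: v) (incl j (i :: v) (left (i :: v) r)) =
      incl i (j :: i :: v) (incl j (i :: v) (incl i v (left v (r - X a * δ r)))) +
      innerVar i j (i :: v) a *
        incl i (j :: i :: v) (incl j (i :: v) (incl i v (left v (δ r)))) := by
  rw [hi.left_eq, map_add, map_mul, map_add, map_mul, incl_incl_left hac hi hj,
    ← incl_left (w := v) (hi.sub_mul_mem r), ← incl_left (w := v) (hi.map_mem r)]

/-- The quadratic equation of `x_a` over `R^{s_i}`, its coefficients moved to the left end. -/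
theorem innerVar_mul_self (hi : IsDividedDifference a b δ) (v : List (Fin n)) :
    innerVar i j v a * innerVar i j v a =
      innerVar i j v a * left (i :: j :: v) (X a + X b) - left (i :: j :: v) (X a * X b) := by
  rw [← incl_left hi.add_mem, ← incl_left hi.mul_mem, innerVar, ← map_mul, ← map_mul, ← map_mul,
    ← map_sub, ← map_mul, ← map_sub]
  congr 2
  ring

/-- As a bimodule, `B_i B_j B_i` is generated by `1 ⊗ 1 ⊗ 1 ⊗ 1` and `1 ⊗ x_a ⊗ 1 ⊗ 1`. -/
theorem adjacent_induction (hac : a ≠ c) (hi : IsDividedDifference a b δ)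
    (hj : IsDividedDifference b c δ') {P : BS [i, j, i] → Prop}
    (h0 : ∀ p r : Poly n, P (left [i, j, i] p * right [i, j, i] r))
    (h1 : ∀ p r : Poly n, P (left [i, j, i] p * innerVar i j [i] a * right [i, j, i] r))
    (h2 : ∀ s t, P s → P t → P (s + t)) (m : BS [i, j, i]) : P m := by
  induction m using induction_cons with
  | h1 p m =>
    induction m using induction_cons with
    | h1 q m =>
      induction m using induction_cons with
      | h1 r m =>
        obtain ⟨s, hs⟩ := exists_left_nil m
        rw [hs]
        have e4 : ∀ r, incl i [j, i] (incl j [i] (incl i [] (left [] r))) = right [i, j, i] r :=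
          fun _ => rfl
        have e : left [i, j, i] p * incl i [j, i] (left [j, i] q * incl j [i] (left [i] r *
            incl i [] (left [] s))) =
            left [i, j, i] (p * (q - X a * δ q)) * right [i, j, i] ((r - X a * δ r) * s) +
            (left [i, j, i] (p * (q - X a * δ q)) * innerVar i j [i] a *
              right [i, j, i] (δ r * s) +
            (left [i, j, i] (p * δ q) * innerVar i j [i] a *
              right [i, j, i] ((r - X a * δ r) * s) +
            (left [i, j, i] (p * δ q * (X a + X b)) * innerVar i j [i] a *
              right [i, j, i] (δ r * s) +
            left [i, j, i] (-(p * δ q * (X a * X b))) * right [i, j, i] (δ r * s)))) := by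
          rw [map_mul, map_mul, map_mul, map_mul, incl_left_eq hi, incl_incl_left_eq hac hi hj, e4,
            e4, e4]
          have := innerVar_mul_self (j := j) hi [i]
          simp only [map_mul, map_neg] at this ⊢
          linear_combination (left [i, j, i] p * left [i, j, i] (δ q) * right [i, j, i] (δ r) *
            right [i, j, i] s) * this
        rw [e]
        exact h2 _ _ (h0 _ _) (h2 _ _ (h1 _ _) (h2 _ _ (h1 _ _) (h2 _ _ (h1 _ _) (h0 _ _))))
      | h2 s t hs ht => rw [map_add, mul_add, map_add, mul_add]; exact h2 _ _ hs ht
    | h2 s t hs ht => rw [map_add, mul_add]; exact h2 _ _ hs ht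
  | h2 s t hs ht => exact h2 _ _ hs ht

theorem adjacent_hom_ext (hac : a ≠ c) (hi : IsDividedDifference a b δ)
    (hj : IsDividedDifference b c δ') {w : List (Fin n)} {f g : BSHom [i, j, i] w}
    (h1 : f 1 = g 1) (hu : f (innerVar i j [i] a) = g (innerVar i j [i] a)) : f = g :=
  BSHom.ext_of_forall fun m => by
    induction m using adjacent_induction hac hi hj with
    | h0 p r => rw [f.map_left_mul_right, g.map_left_mul_right, h1]
    | h1 p r => rw [f.map_left_mul_mul_right, g.map_left_mul_mul_right, hu]
    | h2 s t hs ht => rw [f.map_add_apply, g.map_add_apply, hs, ht]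

/-- The relation between the generators of `B_i B_j B_i`. -/
theorem innerVar_mul_sub (hac : a ≠ c) (hi : IsDividedDifference a b δ)
    (hj : IsDividedDifference b c δ') :
    innerVar i j [i] a * (left [i, j, i] (X c) - right [i, j, i] (X c)) =
      right [i, j, i] (X a * X b) - left [i, j, i] (X a * X b) := by
  have c1 : (X c : Poly n) ∈ invariants i := hi.mem_of_ne hac.symm hj.1.symm
  have e1 : right [i, j, i] (X c) = incl i [j, i] (incl j [i] (left [i] (X c))) := by
    rw [← incl_left c1]; rfl
  have e2 : right [i, j, i] (X a * X b) =
      incl i [j, i] (incl j [i] (left [i] (X a * X b))) := by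
    rw [← incl_left hi.mul_mem]; rfl
  have e3 : innerVar i j [i] a = incl i [j, i] (incl j [i] (left [i] (X a))) :=
    (incl_incl_left hac hi hj [i]).symm
  have e4 : incl j [i] (left [i] (X b + X c)) = left [j, i] (X b + X c) := incl_left hj.add_mem
  have e5 : incl i [j, i] (left [j, i] (X a)) = innerVar i j [i] a := rfl
  -- All outer polynomials are brought into the two middle slots, where `x_a` is common to both. The
  -- claim then reduces to `x_b + x_c` crossing the middle tensor sign.
  rw [← incl_left c1, e1, ← incl_left hi.mul_mem, e2]
  simp only [map_mul, map_add, e5, ← e3] at e4 ⊢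
  have e6 := congrArg (incl i [j, i]) e4
  simp only [map_add] at e6
  linear_combination -innerVar i j [i] a * e6

/-- The action of a simple reflection, as a map of algebras over its invariants. -/
def reflectInvariants (i : Fin n) : Poly n →ₐ[invariants i] Poly n :=
  { reflect i with commutes' := fun r => reflect_coe r }

/-- Evaluation of Bott-Samelson bimodules at a subexpression. -/
def evalAt : (w : List (Fin n)) → List Bool → (BS w →ₐ[Poly n] Poly n)
  | [], _ => AlgHom.id (Poly n) (Poly n)
  | i :: w, s => Algebra.TensorProduct.lift (R := invariants i) (S := Poly n) (A := Poly n)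
      (B := BS w) (AlgHom.id (Poly n) (Poly n))
      ((bif s.headD false then reflectInvariants i else AlgHom.id (invariants i) (Poly n)).comp
        ((evalAt w s.tail).restrictScalars (invariants i)))
      (fun _ _ => Commute.all _ _)

theorem evalAt_left (w : List (Fin n)) (s : List Bool) (p : Poly n) : evalAt w s (left w p) = p :=
  (evalAt w s).commutes p

theorem evalAt_incl (i : Fin n) (w : List (Fin n)) (s : List Bool) (m : BS w) :
    evalAt (i :: w) s (incl i w m) =
      bif s.headD false then reflect i (evalAt w s.tail m) else evalAt w s.tail m := by
  refine (Algebra.TensorProduct.lift_tmul _ _ _ _ _).trans ?_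
  rw [map_one, one_mul]
  cases s.headD false <;> rfl

theorem evalAt_nil_right (s : List Bool) (p : Poly n) :
    evalAt ([] : List (Fin n)) s (right [] p) = p := rfl

theorem swap_braid {a b c : Fin (n + 1)} (hab : a ≠ b) (hbc : b ≠ c) (hac : a ≠ c) :
    Equiv.swap a b * Equiv.swap b c * Equiv.swap a b =
      Equiv.swap b c * Equiv.swap a b * Equiv.swap b c := by
  have h := Equiv.swap_mul_swap_mul_swap hbc.symm hac.symm
  rw [Equiv.swap_comm b a, Equiv.swap_comm c b] at h
  rw [h, Equiv.swap_mul_swap_mul_swap hab hac, Equiv.swap_comm]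

theorem reflect_braid (hac : a ≠ c) (hi : IsDividedDifference a b δ)
    (hj : IsDividedDifference b c δ') (p : Poly n) :
    reflect i (reflect j (reflect i p)) = reflect j (reflect i (reflect j p)) := by
  have h : ((reflect i).comp ((reflect j).comp (reflect i))) =
      ((reflect j).comp ((reflect i).comp (reflect j))) := by
    refine MvPolynomial.algHom_ext fun k => ?_
    have := congrArg (fun s : Equiv.Perm (Fin (n + 1)) => s k) (swap_braid hi.1 hj.1 hac)
    simp only [Equiv.Perm.mul_apply] at this
    simp only [AlgHom.comp_apply, reflect_X, hi.2.1, hj.2.1, this]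
  exact congrArg (fun φ : Poly n →ₐ[ℝ] Poly n => φ p) h

/-- Evaluations take values in a domain, and the factor `x_a ⊗ 1 - 1 ⊗ x_a` has nonzero value at a
subexpression moving `x_a`. Comparing the subexpressions `s_i` at either end gives `γ = 0`; `s_i
s_j` and `s_j s_i` then give `s_j β = β` and `s_j s_i β = s_i β`. The braid relation yields `s_i β =
β`, so `β` passes to the left and cancels `α`. -/
theorem eq_zero_of_mul_eq_zero (hac : a ≠ c) (hi : IsDividedDifference a b δ)
    (hj : IsDividedDifference b c δ') (α β : Poly n) (γ : ℝ)
    (h : (left [i, j, i] α + right [i, j, i] β + left [i, j, i] (C γ) * innerVar i j [i] a) *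
      (left [i, j, i] (X a) - right [i, j, i] (X a)) = 0) :
    left [i, j, i] α + right [i, j, i] β + left [i, j, i] (C γ) * innerVar i j [i] a = 0 := by
  have hC : reflect i (X c : Poly n) = X c := hi.mem_of_ne hac.symm hj.1.symm
  have hA : reflect j (X a : Poly n) = X a := hj.mem_of_ne hi.1 hac
  have key : ∀ s x, evalAt [i, j, i] s (right [i, j, i] (X a)) = x → X a - x ≠ 0 →
      α + evalAt [i, j, i] s (right [i, j, i] β) +
        C γ * evalAt [i, j, i] s (innerVar i j [i] a) = 0 := by
    intro s x hx hne
    have h1 := congrArg (evalAt [i, j, i] s) h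
    rw [map_zero, map_mul] at h1
    rcases mul_eq_zero.1 h1 with h2 | h2
    · simpa only [map_add, map_mul, evalAt_left] using h2
    · rw [map_sub, evalAt_left, hx] at h2
      exact absurd h2 hne
  simp only [right_cons, evalAt_incl, innerVar, evalAt_left, evalAt_nil_right] at key
  have hab := X_sub_X_ne_zero hi.1
  have k1 := key [true, false, false] (X b) (by simp [hi.reflect_X_left]) hab
  have k2 := key [false, false, true] (X b) (by simp [hi.reflect_X_left]) hab
  have k3 := key [true, true, false] (X b) (by simp [hi.reflect_X_left, hA]) hab
  have k4 := key [false, true, true] (X c) (by simp [hi.reflect_X_left, hj.reflect_X_left])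
    (X_sub_X_ne_zero hac)
  simp only [List.headD_cons, List.tail_cons, cond_true, cond_false, hi.reflect_X_left]
    at k1 k2 k3 k4
  have hγ : (C γ : Poly n) = 0 := by
    have : C γ * (X a - X b : Poly n) = 0 := by linear_combination k2 - k1
    exact (mul_eq_zero.1 this).resolve_right hab
  rw [hγ] at k1 k3 k4 ⊢
  have hj' : reflect j β = β := by
    have := congrArg (reflect i) (show reflect i (reflect j β) = reflect i β by
      linear_combination k3 - k1)
    rwa [reflect_reflect, reflect_reflect] at this
  have hji : reflect j (reflect i β) = reflect i β := by linear_combination k4 - k1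
  have hi' : reflect i β = β := by
    have := reflect_braid hac hi hj β
    rw [hji, reflect_reflect, hj', hji] at this
    exact this.symm
  have hβ : left [i, j, i] β = right [i, j, i] β := left_eq_right _ fun k hk => by
    simp only [List.mem_cons, List.not_mem_nil, or_false] at hk
    rcases hk with rfl | rfl | rfl <;> assumption
  have hα : α = -β := by linear_combination k1 - hi'
  rw [← hβ, hα]
  simp

/-- Degree `-1` is two above the bottom degree `-3`, so only linear forms in a single slot occur; in
the two middle slots a linear form is an `s_i`-invariant, which moves to an end, plus a scalar
multiple of `x_a`. -/
theorem mem_gradedPiece_neg_one (hac : a ≠ c) (hi : IsDividedDifference a b δ)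
    (hj : IsDividedDifference b c δ') (m : BS [i, j, i]) (hm : m ∈ gradedPiece [i, j, i] (-1)) :
    ∃ (α β : Poly n) (γ : ℝ),
      m = left [i, j, i] α + right [i, j, i] β + left [i, j, i] (C γ) * innerVar i j [i] a := by
  have hconst : ∀ q : Poly n, q.IsHomogeneous 1 → ∃ γ, δ q = C γ := fun q hq =>
    isHomogeneous_zero_eq_C (hi.map_isHomogeneous hq)
  refine AddSubgroup.closure_induction (p := fun m _ => ∃ (α β : Poly n) (γ : ℝ),
      m = left [i, j, i] α + right [i, j, i] β + left [i, j, i] (C γ) * innerVar i j [i] a)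
    ?_ ?_ ?_ ?_ (gradedPiece_le_closure_linearElements [i, j, i] m hm)
  · rintro _ (⟨p, _, rfl⟩ | ⟨_, (⟨q, hq, rfl⟩ | ⟨_, (⟨r, hr, rfl⟩ | ⟨s, _, rfl⟩), rfl⟩), rfl⟩)
    · exact ⟨p, 0, 0, by simp⟩
    · obtain ⟨γ, hγ⟩ := hconst q hq
      refine ⟨q - X a * δ q, 0, γ, ?_⟩
      rw [incl_left_eq hi, hγ, map_zero]
      ring
    · obtain ⟨γ, hγ⟩ := hconst r hr
      refine ⟨0, r - X a * δ r, γ, ?_⟩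
      rw [incl_incl_left_eq hac hi hj, hγ, incl_left_C, incl_left_C, incl_left_C]
      change right [i, j, i] (r - X a * C γ) + _ = _
      rw [map_zero]
      ring
    · exact ⟨0, s, 0, by simp; rfl⟩
  · exact ⟨0, 0, 0, by simp⟩
  · rintro _ _ _ _ ⟨α, β, γ, rfl⟩ ⟨α', β', γ', rfl⟩
    exact ⟨α + α', β + β', γ + γ', by simp only [map_add]; ring⟩
  · rintro _ _ ⟨α, β, γ, rfl⟩
    exact ⟨-α, -β, -γ, by simp only [map_neg]; ring⟩

theorem innerVar_mem_gradedPiece (i j : Fin n) (a : Fin (n + 1)) :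
    innerVar i j [i] a ∈ gradedPiece [i, j, i] (-1) := by
  have h1 := left_mul_mem_gradedPiece (isHomogeneous_X ℝ a) 1 (one_mem_gradedPiece [j, i])
  have h2 := mem_gradedPiece_cons (i := i) (isHomogeneous_one (Fin (n + 1)) ℝ) h1 (d := -1)
    (by simp)
  rw [map_one, one_mul, mul_one] at h2
  exact h2

/-- The value of a braid morphism on the second generator of `B_i B_j B_i`. -/
theorem IsBraidMorphism.map_innerVar (hac : a ≠ c) (hi : IsDividedDifference a b δ)
    (hj : IsDividedDifference b c δ') {f : BSHom [i, j, i] [j, i, j]} (hf : IsBraidMorphism f) :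
    f (innerVar i j [i] a) = left [j, i, j] (X a + X b) - right [j, i, j] (X c) := by
  obtain ⟨⟨i1, j1⟩, ⟨i2, j2⟩, -, -⟩ := adjacent_invariants hac hi hj
  have hlr : ∀ e : Poly n, e ∈ invariants i → e ∈ invariants j →
      left [j, i, j] e = right [j, i, j] e := fun e he he' => left_eq_right _ fun k hk => by
    simp only [List.mem_cons, List.not_mem_nil, or_false] at hk
    rcases hk with rfl | rfl | rfl <;> assumption
  have h1 := hlr _ i1 j1
  have h2 := hlr _ i2 j2
  have hu : f (innerVar i j [i] a) * (left [j, i, j] (X c) - right [j, i, j] (X c)) =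
      right [j, i, j] (X a * X b) - left [j, i, j] (X a * X b) := by
    -- Applying `f` to the relation between the generators determines the image of `u` up to the
    -- annihilator of `x_c ⊗ 1 - 1 ⊗ x_c`.
    have h := congrArg f.toLinearMap (innerVar_mul_sub hac hi hj)
    change f _ = f _ at h
    rw [mul_sub, mul_comm _ (left _ _), f.map_sub_apply, f.map_sub_apply, f.map_left_mul,
      f.map_mul_right, ← mul_one (left _ (X a * X b)), f.map_left_mul,
      ← one_mul (right _ (X a * X b)), f.map_mul_right, hf.2, one_mul, mul_one] at h
    rw [← h]
    ring
  -- The target is `B_j B_i B_j`, so the variables are taken in the order `c`, `b`, `a`.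
  obtain ⟨α, β, γ, h⟩ := mem_gradedPiece_neg_one hac.symm hj.neg hi.neg _
    (hf.1 _ _ (innerVar_mem_gradedPiece i j a))
  have h0 := eq_zero_of_mul_eq_zero hac.symm hj.neg hi.neg (α - (X a + X b)) (β + X c) γ
  have e : left [j, i, j] (α - (X a + X b)) + right [j, i, j] (β + X c) +
      left [j, i, j] (C γ) * innerVar j i [j] c =
      f (innerVar i j [i] a) - (left [j, i, j] (X a + X b) - right [j, i, j] (X c)) := by
    rw [h, map_sub (left [j, i, j]), map_add (right [j, i, j])]
    ring
  rw [e] at h0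
  refine sub_eq_zero.1 (h0 ?_)
  rw [sub_mul, hu]
  simp only [map_add, map_mul] at h1 h2 ⊢
  linear_combination right [j, i, j] (X c) * h1 - h2

theorem Adjacent.existsUnique (h : Adjacent i j) :
    ∃! f : BSHom [i, j, i] [j, i, j], IsBraidMorphism f := by
  obtain ⟨f, hf⟩ := h.exists_isBraidMorphism
  obtain ⟨a, b, c, δ, hac, hi, hj⟩ := h.exists_dividedDifferences
  refine ⟨f, hf, fun g hg => adjacent_hom_ext hac hi hj (hg.2.trans hf.2.symm) ?_⟩
  rw [hf.map_innerVar hac hi hj, hg.map_innerVar hac hi hj]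

end Adjacent

end Uniqueness

/-! ### Round trips along edges -/

section RoundTrip

open MvPolynomial

variable {n : ℕ}

theorem Distant.isBraidMorphism {i j : Fin n} (h : Distant i j) :
    IsBraidMorphism (braidMorphism [i, j] [j, i]) :=
  Classical.epsilon_spec h.exists_isBraidMorphism

theorem Adjacent.isBraidMorphism {i j : Fin n} (h : Adjacent i j) :
    IsBraidMorphism (braidMorphism [i, j, i] [j, i, j]) :=
  Classical.epsilon_spec h.exists_isBraidMorphism

theorem IsBraidMorphism.comp {x y z : List (Fin n)} {g : BSHom y z} {f : BSHom x y}
    (hg : IsBraidMorphism g) (hf : IsBraidMorphism f) : IsBraidMorphism (g.comp f) :=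
  ⟨fun d m hm => hg.1 d _ (hf.1 d m hm), by rw [BSHom.comp_apply, hf.2, hg.2]⟩

theorem BSHom.comp_assoc {w x y z : List (Fin n)} (h : BSHom y z) (g : BSHom x y)
    (f : BSHom w x) : (h.comp g).comp f = h.comp (g.comp f) := rfl

theorem BSHom.id_comp {w x : List (Fin n)} (f : BSHom w x) : (BSHom.id x).comp f = f := rfl

theorem BSHom.comp_id {w x : List (Fin n)} (f : BSHom w x) : f.comp (BSHom.id w) = f := rfl

/-- Going along a braid move and back. -/
def roundTrip {w w' : List (Fin n)} (m : BraidMove w w') : BSHom w w :=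
  m.symm.morphism.comp m.morphism

theorem roundTrip_cons (a : Fin n) {w w' : List (Fin n)} (m : BraidMove w w') :
    roundTrip (.cons a m) = (roundTrip m).whiskerLeft a :=
  (BSHom.whiskerLeft_comp a _ _).symm

/-- The projector `f_{ji} f_{ij}` of `B_i B_j B_i`. -/
def adjacentProjector (i j : Fin n) : BSHom [i, j, i] [i, j, i] :=
  (braidMorphism [j, i, j] [i, j, i]).comp (braidMorphism [i, j, i] [j, i, j])

theorem roundTrip_adjacent (i j : Fin n) (h : Adjacent i j) (v : List (Fin n)) :
    roundTrip (.adjacent i j h v) = (adjacentProjector i j).whiskerRight v :=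
  (BSHom.whiskerRight_comp _ _ v).symm

theorem roundTrip_of_isDistant {w w' : List (Fin n)} (m : BraidMove w w') (hm : m.IsDistant) :
    roundTrip m = BSHom.id w := by
  induction m with
  | distant i j h v =>
    have : (braidMorphism [j, i] [i, j]).comp (braidMorphism [i, j] [j, i]) = BSHom.id [i, j] :=
      h.hom_ext (h.symm.isBraidMorphism.comp h.isBraidMorphism).2
    refine (BSHom.whiskerRight_comp _ _ v).symm.trans ?_
    rw [this]
    exact BSHom.whiskerRight_id _ _
  | adjacent i j h v => exact hm.elim
  | cons a m ih => rw [roundTrip_cons, ih hm, BSHom.whiskerLeft_id]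

/-- For an adjacent move, `f_{ij} f_{ji} f_{ij}` has degree `0` and fixes `1^⊗`, so it is `f_{ij}`
by uniqueness. -/
theorem morphism_comp_roundTrip {w w' : List (Fin n)} (m : BraidMove w w') :
    m.morphism.comp (roundTrip m) = m.morphism := by
  induction m with
  | distant i j h v =>
    rw [roundTrip_of_isDistant (.distant i j h v) trivial, BSHom.comp_id]
  | adjacent i j h v =>
    have : (braidMorphism [i, j, i] [j, i, j]).comp (adjacentProjector i j) =
        braidMorphism [i, j, i] [j, i, j] :=
      h.existsUnique.unique
        (h.isBraidMorphism.comp (h.symm.isBraidMorphism.comp h.isBraidMorphism)) h.isBraidMorphism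
    rw [roundTrip_adjacent]
    exact (BSHom.whiskerRight_comp _ _ v).symm.trans (congrArg (fun f => BSHom.whiskerRight f v) this)
  | cons a m ih =>
    rw [roundTrip_cons]
    exact (BSHom.whiskerLeft_comp a _ _).symm.trans (congrArg (fun f => BSHom.whiskerLeft a f) ih)

/-- The element `x_b ⊗ 1 - 1 ⊗ x_c`, the value at `1` of a map `R → B_j`. -/
def unitElement (j : Fin n) (v : List (Fin n)) (b c : Fin (n + 1)) : BS (j :: v) :=
  left (j :: v) (X b) - incl j v (left v (X c))

/-- By `R = R^{s_j} + x_b R^{s_j}` only `x = x_b` matters, and there the claim follows from `x_b +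
x_c` and `x_b x_c` crossing the tensor sign. -/
theorem unitElement_mul {j : Fin n} {b c : Fin (n + 1)} {δ : Poly n →ₗ[invariants j] Poly n}
    (hj : IsDividedDifference b c δ) (v : List (Fin n)) (x : Poly n) :
    unitElement j v b c * incl j v (left v x) = unitElement j v b c * left (j :: v) x := by
  have h1 := incl_left (w := v) hj.add_mem
  have h2 := incl_left (w := v) hj.mul_mem
  rw [hj.left_eq v x, hj.left_eq (j :: v) x, map_add, map_mul (incl j v),
    incl_left (hj.sub_mul_mem x), incl_left (hj.map_mem x), unitElement]
  simp only [map_add, map_mul] at h1 h2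
  linear_combination left (j :: v) (δ x) * (left (j :: v) (X b) * h1 - h2)

variable {i j : Fin n} {a b c : Fin (n + 1)} {δ : Poly n →ₗ[invariants i] Poly n}
  {δ' : Poly n →ₗ[invariants j] Poly n}

/-- The idempotent fixes `1^⊗` and sends `u` to `u + η`, where `η` is `x_b ⊗ 1 - 1 ⊗ x_c` in the
middle slots. Expressing `p ⊗ q ⊗ r ⊗ 1` through the generators, the coefficient of `u` collects to
`δ(q r)`, since `s_i`-invariants pass across `η`. -/
theorem adjacentProjector_apply (h : Adjacent i j) (hac : a ≠ c) (hi : IsDividedDifference a b δ)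
    (hj : IsDividedDifference b c δ') (p q r : Poly n) :
    adjacentProjector i j (left [i, j, i] p * incl i [j, i] (left [j, i] q *
      incl j [i] (left [i] r))) =
      left [i, j, i] p * incl i [j, i] (left [j, i] q * incl j [i] (left [i] r)) +
        left [i, j, i] (p * δ (q * r)) * incl i [j, i] (unitElement j [i] b c) := by
  have hp1 : adjacentProjector i j 1 = 1 := (h.symm.isBraidMorphism.comp h.isBraidMorphism).2
  have hpu : adjacentProjector i j (innerVar i j [i] a) =
      innerVar i j [i] a + incl i [j, i] (unitElement j [i] b c) := by
    have c1 : (X c : Poly n) ∈ invariants i := hi.mem_of_ne hac.symm hj.1.symm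
    have e1 : right [i, j, i] (X c) = incl i [j, i] (incl j [i] (left [i] (X c))) := by
      rw [← incl_left c1]; rfl
    have hf1 := h.symm.isBraidMorphism.2
    rw [adjacentProjector, BSHom.comp_apply, h.isBraidMorphism.map_innerVar hac hi hj,
      BSHom.map_sub_apply, ← mul_one (left _ _), BSHom.map_left_mul, ← one_mul (right _ _),
      BSHom.map_mul_right, hf1, mul_one, one_mul, ← incl_left hi.add_mem, e1, unitElement,
      innerVar, map_sub, map_add, map_add]
    ring
  have hη : ∀ x ∈ invariants i, incl i [j, i] (unitElement j [i] b c) * right [i, j, i] x =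
      incl i [j, i] (unitElement j [i] b c) * left [i, j, i] x := by
    intro x hx
    have e1 : right [i, j, i] x = incl i [j, i] (incl j [i] (left [i] x)) := by
      rw [← incl_left hx]; rfl
    rw [e1, ← map_mul, unitElement_mul hj, map_mul, incl_left hx]
  have e4 : ∀ r, incl i [j, i] (incl j [i] (incl i [] (left [] r))) = right [i, j, i] r :=
    fun _ => rfl
  have e : left [i, j, i] p * incl i [j, i] (left [j, i] q * incl j [i] (left [i] r)) =
      left [i, j, i] (p * (q - X a * δ q)) * right [i, j, i] (r - X a * δ r) +
      (left [i, j, i] (p * (q - X a * δ q)) * innerVar i j [i] a * right [i, j, i] (δ r) +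
      (left [i, j, i] (p * δ q) * innerVar i j [i] a * right [i, j, i] (r - X a * δ r) +
      (left [i, j, i] (p * δ q * (X a + X b)) * innerVar i j [i] a * right [i, j, i] (δ r) +
      left [i, j, i] (-(p * δ q * (X a * X b))) * right [i, j, i] (δ r)))) := by
    rw [map_mul, incl_left_eq hi, incl_incl_left_eq hac hi hj, e4, e4]
    have := innerVar_mul_self (j := j) hi [i]
    simp only [map_mul, map_neg] at this ⊢
    linear_combination (left [i, j, i] p * left [i, j, i] (δ q) * right [i, j, i] (δ r)) * this
  have hδ : δ (q * r) = (q - X a * δ q) * δ r + δ q * (r - X a * δ r) + δ q * δ r * (X a + X b) := by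
    refine hi.eq_of_mul_eq ?_
    have t1 := hi.2.2 q
    have t2 := hi.2.2 r
    rw [map_mul]
    linear_combination ((X a - X b) * δ q - q) * t2 - reflect i r * t1
  rw [e]
  simp only [BSHom.map_add_apply, BSHom.map_left_mul_right, BSHom.map_left_mul_mul_right, hp1, hpu,
    one_mul]
  have h1 := hη _ (hi.map_mem r)
  have h2 := hη _ (hi.sub_mul_mem r)
  rw [hδ]
  simp only [map_mul, map_add, map_neg] at h1 h2 ⊢
  linear_combination (left [i, j, i] p * left [i, j, i] (q - X a * δ q) + left [i, j, i] p *
    left [i, j, i] (δ q) * (left [i, j, i] (X a) + left [i, j, i] (X b))) * h1 +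
    left [i, j, i] p * left [i, j, i] (δ q) * h2

theorem whiskerRight_adjacentProjector_apply (h : Adjacent i j) (hac : a ≠ c)
    (hi : IsDividedDifference a b δ) (hj : IsDividedDifference b c δ') (v : List (Fin n))
    (p q r : Poly n) (m : BS v) :
    (adjacentProjector i j).whiskerRight v (left (i :: j :: i :: v) p *
      incl i (j :: i :: v) (left (j :: i :: v) q *
        incl j (i :: v) (left (i :: v) r * incl i v m))) =
      left (i :: j :: i :: v) p * incl i (j :: i :: v) (left (j :: i :: v) q *
        incl j (i :: v) (left (i :: v) r * incl i v m)) +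
      left (i :: j :: i :: v) (p * δ (q * r)) * incl i (j :: i :: v)
        (unitElement j (i :: v) b c * incl j (i :: v) (incl i v m)) := by
  have h1 := BSHom.whiskerRight_apply (adjacentProjector i j) v (left [i, j, i] p *
    incl i [j, i] (left [j, i] q * incl j [i] (left [i] r))) m
  have e1 : inl [i, j, i] v (left [i, j, i] p * incl i [j, i] (left [j, i] q *
      incl j [i] (left [i] r))) = (left (i :: j :: i :: v) p * incl i (j :: i :: v)
        (left (j :: i :: v) q * incl j (i :: v) (left (i :: v) r)) : BS (i :: j :: i :: v)) := by
    rw [inl_cons, inl_cons, inl_left]; rfl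
  have e2 : inl [i, j, i] v (left [i, j, i] (p * δ (q * r)) * incl i [j, i]
      (unitElement j [i] b c)) = (left (i :: j :: i :: v) (p * δ (q * r)) *
        incl i (j :: i :: v) (unitElement j (i :: v) b c) : BS (i :: j :: i :: v)) := by
    rw [inl_cons, unitElement, map_sub, inl_left, inl_incl, inl_left]; rfl
  rw [adjacentProjector_apply h hac hi hj, map_add, e1, e2] at h1
  change (adjacentProjector i j).whiskerRight v (left (i :: j :: i :: v) p * incl i (j :: i :: v)
        (left (j :: i :: v) q * incl j (i :: v) (left (i :: v) r)) *
          incl i (j :: i :: v) (incl j (i :: v) (incl i v m))) =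
    (left (i :: j :: i :: v) p * incl i (j :: i :: v)
        (left (j :: i :: v) q * incl j (i :: v) (left (i :: v) r)) +
      left (i :: j :: i :: v) (p * δ (q * r)) *
        incl i (j :: i :: v) (unitElement j (i :: v) b c)) *
          incl i (j :: i :: v) (incl j (i :: v) (incl i v m)) at h1
  simp only [map_mul, mul_assoc, add_mul] at h1 ⊢
  exact h1

/-- `H` multiplies the slot of `r` by the `s_i`-invariant `e` in its correction term. In one order
`e` comes out of `δ(q r e) = e δ(q r)`; in the other it stands to the right of `η`, passes to its
left by `unitElement_mul` and crosses the sign over `R^{s_i}`. The two results agree. -/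
theorem comp_comm_apply {w : List (Fin n)} (hi : IsDividedDifference a b δ)
    (hj : IsDividedDifference b c δ') {E H : BSHom (i :: j :: i :: w) (i :: j :: i :: w)}
    {F : BSHom (i :: w) (i :: w)}
    (hE : ∀ (p q r : Poly n) (m : BS w), E (left (i :: j :: i :: w) p * incl i (j :: i :: w)
      (left (j :: i :: w) q * incl j (i :: w) (left (i :: w) r * incl i w m))) =
        left (i :: j :: i :: w) p * incl i (j :: i :: w) (left (j :: i :: w) q * incl j (i :: w)
          (left (i :: w) r * incl i w m)) +
        left (i :: j :: i :: w) (p * δ (q * r)) * incl i (j :: i :: w)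
          (unitElement j (i :: w) b c * incl j (i :: w) (incl i w m)))
    (hH : ∀ (p q : Poly n) (y : BS (i :: w)), H (left (i :: j :: i :: w) p * incl i (j :: i :: w)
      (left (j :: i :: w) q * incl j (i :: w) y)) = left (i :: j :: i :: w) p *
        incl i (j :: i :: w) (left (j :: i :: w) q * incl j (i :: w) (F y)))
    {e : Poly n} (he : e ∈ invariants i) {M M' : BS w}
    (hF : ∀ r, F (left (i :: w) r * incl i w M) = left (i :: w) r * incl i w M +
      left (i :: w) (r * e) * incl i w M') (p q r : Poly n) :
    E (H (left (i :: j :: i :: w) p * incl i (j :: i :: w) (left (j :: i :: w) q *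
      incl j (i :: w) (left (i :: w) r * incl i w M)))) =
    H (E (left (i :: j :: i :: w) p * incl i (j :: i :: w) (left (j :: i :: w) q *
      incl j (i :: w) (left (i :: w) r * incl i w M)))) := by
  have e1 : left (i :: j :: i :: w) (p * δ (q * r)) * incl i (j :: i :: w)
      (unitElement j (i :: w) b c * incl j (i :: w) (incl i w M)) =
      left (i :: j :: i :: w) (p * δ (q * r)) * incl i (j :: i :: w) (left (j :: i :: w) (X b) *
        incl j (i :: w) (left (i :: w) 1 * incl i w M)) -
      left (i :: j :: i :: w) (p * δ (q * r)) * incl i (j :: i :: w) (left (j :: i :: w) 1 *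
        incl j (i :: w) (left (i :: w) (X c) * incl i w M)) := by
    rw [← mul_sub, ← map_sub, unitElement, map_one, map_one, one_mul, one_mul,
      map_mul (incl j (i :: w)), sub_mul]
  have e2 : δ (q * (r * e)) = e * δ (q * r) := by
    rw [← hi.map_mul_of_mem he]; congr 1; ring
  have e3 := congrArg (incl i (j :: i :: w)) (unitElement_mul hj (i :: w) e)
  rw [map_mul, map_mul, incl_left he] at e3
  rw [hE, e1, BSHom.map_add_apply, BSHom.map_sub_apply, hH, hH, hH, hF, hF, hF]
  simp only [map_add, mul_add, hE, e2]
  simp only [unitElement, map_mul, map_sub, map_one, one_mul] at e3 ⊢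
  linear_combination -left (i :: j :: i :: w) p * left (i :: j :: i :: w) (δ (q * r)) *
    incl i (j :: i :: w) (incl j (i :: w) (incl i w M')) * e3

/-- The projectors of overlapping adjacent pairs commute. -/
theorem adjacentProjector_comm {i j k : Fin n} (hij : Adjacent i j) (hik : Adjacent i k)
    (v : List (Fin n)) :
    ((adjacentProjector i j).whiskerRight (k :: i :: v)).comp
      ((((adjacentProjector i k).whiskerRight v).whiskerLeft j).whiskerLeft i) =
    ((((adjacentProjector i k).whiskerRight v).whiskerLeft j).whiskerLeft i).comp
      ((adjacentProjector i j).whiskerRight (k :: i :: v)) := by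
  obtain ⟨a, b, c, δ, hac, hi, hj⟩ := hij.exists_dividedDifferences
  obtain ⟨a', b', c', δ', hac', hi', hk⟩ := hik.exists_dividedDifferences
  refine BSHom.ext_of_forall fun t => ?_
  induction t using induction_cons (i := i) (w := j :: i :: k :: i :: v) with
  | h2 s t hs ht => rw [BSHom.map_add_apply, BSHom.map_add_apply, hs, ht]
  | h1 p t =>
    induction t using induction_cons (i := j) (w := i :: k :: i :: v) with
    | h2 s t hs ht =>
      rw [map_add, mul_add, BSHom.map_add_apply, BSHom.map_add_apply, hs, ht]
    | h1 q t =>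
      induction t using induction_cons (i := i) (w := k :: i :: v) with
      | h2 s t hs ht =>
        simp only [map_add, mul_add, hs, ht]
      | h1 r t =>
        induction t using induction_cons (i := k) (w := i :: v) with
        | h2 s t hs ht =>
          simp only [map_add, mul_add, hs, ht]
        | h1 s t =>
          induction t using induction_cons (i := i) (w := v) with
          | h2 s t hs ht =>
            simp only [map_add, mul_add, hs, ht]
          | h1 t m =>
            -- The invariant is `e = δ'(s t)`, a value of a divided difference for the shared letter
            -- `i`.
            refine comp_comm_apply (F := (adjacentProjector i k).whiskerRight v) hi hj
              (whiskerRight_adjacentProjector_apply hij hac hi hj (k :: i :: v)) ?_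
              (hi'.map_mem (s * t)) (fun r =>
                whiskerRight_adjacentProjector_apply hik hac' hi' hk v r s t m) p q r
            intro p q y
            refine (BSHom.whiskerLeft_left_mul_incl i _ p _).trans ?_
            exact congrArg (fun z => left (i :: j :: i :: k :: i :: v) p *
              incl i (j :: i :: k :: i :: v) z) (BSHom.whiskerLeft_left_mul_incl j _ q y)

/-- From `i j i k i` with `j ≠ k` only the moves on the first and on the last three letters are
possible. -/
theorem roundTrip_comm {i j k : Fin n} (hij : Adjacent i j) (hik : Adjacent i k) (hjk : j ≠ k)
    {w w' : List (Fin n)} (m : BraidMove [i, j, i, k, i] w) (m' : BraidMove [i, j, i, k, i] w') :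
    (roundTrip m).comp (roundTrip m') = (roundTrip m').comp (roundTrip m) := by
  have key : ∀ {w : List (Fin n)} (m : BraidMove [i, j, i, k, i] w),
      roundTrip m = (adjacentProjector i j).whiskerRight [k, i] ∨ roundTrip m =
        (((adjacentProjector i k).whiskerRight []).whiskerLeft j).whiskerLeft i := by
    intro w m
    cases m with
    | distant _ _ h => rcases h with h | h <;> rcases hij with h' | h' <;> omega
    | adjacent _ _ h => exact Or.inl (roundTrip_adjacent i j h _)
    | cons _ m =>
      cases m with
      | distant _ _ h => rcases h with h | h <;> rcases hij with h' | h' <;> omega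
      | adjacent => exact absurd rfl hjk
      | cons _ m =>
        cases m with
        | distant _ _ h => rcases h with h | h <;> rcases hik with h' | h' <;> omega
        | adjacent _ _ h =>
          refine Or.inr ?_
          rw [roundTrip_cons, roundTrip_cons, roundTrip_adjacent]
        | cons _ m =>
          cases m with
          | distant _ _ h => rcases h with h | h <;> rcases hik with h' | h' <;> omega
          | cons _ m => cases m with | cons _ m => nomatch m
  rcases key m with h | h <;> rcases key m' with h' | h' <;> rw [h, h']
  · exact adjacentProjector_comm hij hik []
  · exact (adjacentProjector_comm hij hik []).symm

end RoundTrip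

/-! ### Reduced expression graphs that are lines -/

section Line

variable {n : ℕ} {σ : Equiv.Perm (Fin (n + 1))}

/-- The morphism of an edge of the reduced expression graph. -/
def edgeMorphism {v w : ReducedExpr σ} (h : (rexGraph σ).Adj v w) : BSHom v.1 w.1 :=
  (Classical.choice h).morphism

theorem edgeMorphism_eq {v w : ReducedExpr σ} (h : (rexGraph σ).Adj v w)
    (m : BraidMove v.1 w.1) : edgeMorphism h = m.morphism := by
  rw [edgeMorphism, Subsingleton.elim (Classical.choice h) m]

theorem edgeMorphism_symm_comp {v w : ReducedExpr σ} (h : (rexGraph σ).Adj v w)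
    (m : BraidMove v.1 w.1) : (edgeMorphism h.symm).comp (edgeMorphism h) = roundTrip m := by
  rw [edgeMorphism_eq h m, edgeMorphism_eq h.symm m.symm, roundTrip]

theorem edgeMorphism_comp_comp {v w : ReducedExpr σ} (h : (rexGraph σ).Adj v w) :
    (edgeMorphism h).comp ((edgeMorphism h.symm).comp (edgeMorphism h)) = edgeMorphism h := by
  obtain ⟨m⟩ := id h
  rw [edgeMorphism_symm_comp h m, edgeMorphism_eq h m, morphism_comp_roundTrip]

theorem edgeMorphism_comp_of_distantEdge {v w : ReducedExpr σ} (h : (rexGraph σ).Adj v w)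
    (hd : DistantEdge v w) : (edgeMorphism h.symm).comp (edgeMorphism h) = BSHom.id v.1 := by
  obtain ⟨m, hm⟩ := hd
  rw [edgeMorphism_symm_comp h m, roundTrip_of_isDistant m hm]

theorem pathMorphism_cons {u v w : ReducedExpr σ} (h : (rexGraph σ).Adj u v)
    (p : (rexGraph σ).Walk v w) :
    pathMorphism (.cons h p) = (pathMorphism p).comp (edgeMorphism h) := rfl

theorem pathMorphism_append {u v w : ReducedExpr σ} (p : (rexGraph σ).Walk u v)
    (q : (rexGraph σ).Walk v w) :
    pathMorphism (p.append q) = (pathMorphism q).comp (pathMorphism p) := by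
  induction p with
  | nil => rfl
  | cons h p ih =>
    rw [SimpleGraph.Walk.cons_append, pathMorphism_cons, pathMorphism_cons, ih]
    rfl

/-- A family of endomorphisms commuting with the morphisms of all edges. -/
def IsNatural (P : ∀ v : ReducedExpr σ, BSHom v.1 v.1) : Prop :=
  ∀ (v w : ReducedExpr σ) (h : (rexGraph σ).Adj v w),
    (P w).comp (edgeMorphism h) = (edgeMorphism h).comp (P v)

theorem IsNatural.comp_pathMorphism {P : ∀ v : ReducedExpr σ, BSHom v.1 v.1} (hP : IsNatural P)
    {v w : ReducedExpr σ} (p : (rexGraph σ).Walk v w) :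
    (P w).comp (pathMorphism p) = (pathMorphism p).comp (P v) := by
  induction p with
  | nil => rfl
  | cons h p ih =>
    rw [pathMorphism_cons, ← BSHom.comp_assoc, ih, BSHom.comp_assoc, hP, BSHom.comp_assoc]

/-- `P a` is inserted for free when the path visits `a`, then carried to the end by naturality. -/
theorem IsNatural.comp_pathMorphism_of_mem {P : ∀ v : ReducedExpr σ, BSHom v.1 v.1}
    (hP : IsNatural P) {a : ReducedExpr σ} (ha : P a = BSHom.id a.1)
    {v w : ReducedExpr σ} (p : (rexGraph σ).Walk v w) (hp : a ∈ p.support) :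
    (P w).comp (pathMorphism p) = pathMorphism p := by
  classical
  rw [← p.take_spec hp, pathMorphism_append, ← BSHom.comp_assoc, hP.comp_pathMorphism, ha,
    BSHom.comp_id]

/-- Morphisms to and from the vertex `a` of a line, along the line. -/
structure RootMaps (idx : ReducedExpr σ → ℕ) (a : ReducedExpr σ) where
  toRoot : ∀ v : ReducedExpr σ, BSHom v.1 a.1
  fromRoot : ∀ v : ReducedExpr σ, BSHom a.1 v.1
  toRoot_root : toRoot a = BSHom.id a.1
  fromRoot_root : fromRoot a = BSHom.id a.1
  toRoot_succ : ∀ (v w : ReducedExpr σ) (h : (rexGraph σ).Adj v w), idx v + 1 = idx w →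
    toRoot w = (toRoot v).comp (edgeMorphism h.symm)
  fromRoot_succ : ∀ (v w : ReducedExpr σ) (h : (rexGraph σ).Adj v w), idx v + 1 = idx w →
    fromRoot w = (edgeMorphism h).comp (fromRoot v)

/-- The morphisms of the monotone paths between `a` and `v`. -/
inductive IsRootPair (idx : ReducedExpr σ → ℕ) (a : ReducedExpr σ) :
    (v : ReducedExpr σ) → BSHom v.1 a.1 × BSHom a.1 v.1 → Prop
  | root : IsRootPair idx a a (BSHom.id a.1, BSHom.id a.1)
  | step {v w : ReducedExpr σ} (h : (rexGraph σ).Adj v w) (hi : idx v + 1 = idx w)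
      (t : BSHom v.1 a.1 × BSHom a.1 v.1) (ht : IsRootPair idx a v t) :
      IsRootPair idx a w (t.1.comp (edgeMorphism h.symm), (edgeMorphism h).comp t.2)

theorem IsRootPair.unique {idx : ReducedExpr σ → ℕ} (hidx : Function.Injective idx)
    {a : ReducedExpr σ} (ha : idx a = 0) {v : ReducedExpr σ}
    {t : BSHom v.1 a.1 × BSHom a.1 v.1} (ht : IsRootPair idx a v t) :
    ∀ {t'}, IsRootPair idx a v t' → t = t' := by
  induction ht with
  | root =>
    intro t' ht'
    cases ht' with
    | root => rfl
    | step h hi => omega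
  | @step v _ h hi t ht ih =>
    intro t' ht'
    cases ht' with
    | root => omega
    | @step v' _ h' hi' t' ht' =>
      obtain rfl := hidx (show idx v = idx v' by omega)
      rw [ih ht']

/-- Each vertex has a unique predecessor, by injectivity of `idx`. The relation `IsRootPair` encodes
the recursion along the line, which avoids transporting morphisms between the dependent types. -/
theorem exists_rootMaps {idx : ReducedExpr σ → ℕ} (hidx : Function.Injective idx)
    {a : ReducedExpr σ} (ha : idx a = 0)
    (hpred : ∀ v, idx v ≠ 0 → ∃ w, (rexGraph σ).Adj w v ∧ idx w + 1 = idx v) :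
    Nonempty (RootMaps idx a) := by
  have hex : ∀ (k : ℕ) (v : ReducedExpr σ), idx v = k → ∃ t, IsRootPair idx a v t := by
    intro k
    induction k with
    | zero =>
      intro v hv
      obtain rfl := hidx (hv.trans ha.symm)
      exact ⟨_, .root⟩
    | succ k ih =>
      intro v hv
      obtain ⟨w, h, hw⟩ := hpred v (by omega)
      obtain ⟨t, ht⟩ := ih w (by omega)
      exact ⟨_, .step h hw t ht⟩
  choose t ht using fun v => hex _ v rfl
  have hroot := (ht a).unique hidx ha .root
  have hstep : ∀ v w (h : (rexGraph σ).Adj v w) (hi : idx v + 1 = idx w), t w = _ :=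
    fun v w h hi => (ht w).unique hidx ha (.step h hi _ (ht v))
  exact ⟨⟨fun v => (t v).1, fun v => (t v).2, congrArg Prod.fst hroot, congrArg Prod.snd hroot,
    fun v w h hi => congrArg Prod.fst (hstep v w h hi),
    fun v w h hi => congrArg Prod.snd (hstep v w h hi)⟩⟩

namespace RootMaps

variable {idx : ReducedExpr σ → ℕ} {a : ReducedExpr σ} (T : RootMaps idx a)

/-- The morphism of the round trip from `v` to the root. -/
def proj (v : ReducedExpr σ) : BSHom v.1 v.1 := (T.fromRoot v).comp (T.toRoot v)

theorem proj_root : T.proj a = BSHom.id a.1 := by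
  rw [proj, T.toRoot_root, T.fromRoot_root, BSHom.comp_id]

theorem proj_succ {v w : ReducedExpr σ} (h : (rexGraph σ).Adj v w) (hi : idx v + 1 = idx w) :
    T.proj w = (edgeMorphism h).comp ((T.proj v).comp (edgeMorphism h.symm)) := by
  rw [proj, T.toRoot_succ v w h hi, T.fromRoot_succ v w h hi]
  rfl

theorem proj_succ_of_proj_eq_id {v w : ReducedExpr σ} (h : (rexGraph σ).Adj v w)
    (hi : idx v + 1 = idx w) (hv : T.proj v = BSHom.id v.1) :
    T.proj w = (edgeMorphism h).comp (edgeMorphism h.symm) := by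
  rw [T.proj_succ h hi, hv, BSHom.id_comp]

theorem proj_succ_of_distantEdge {v w : ReducedExpr σ} (h : DistantEdge w v)
    (hi : idx v + 1 = idx w) (hv : T.proj v = BSHom.id v.1) : T.proj w = BSHom.id w.1 := by
  obtain ⟨m, hm⟩ := h
  rw [T.proj_succ_of_proj_eq_id ⟨m.symm⟩ hi hv]
  exact edgeMorphism_comp_of_distantEdge ⟨m⟩ ⟨m, hm⟩

/-- The projectors form a natural family if they commute with the round trips along the edges
leading away from the root. -/
theorem isNatural_proj
    (hadj : ∀ v w, (rexGraph σ).Adj v w → idx v + 1 = idx w ∨ idx w + 1 = idx v)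
    (hcomm : ∀ (v w : ReducedExpr σ) (h : (rexGraph σ).Adj v w), idx v + 1 = idx w →
      (T.proj v).comp ((edgeMorphism h.symm).comp (edgeMorphism h)) =
        ((edgeMorphism h.symm).comp (edgeMorphism h)).comp (T.proj v)) : IsNatural T.proj := by
  intro v w h
  rcases hadj v w h with hi | hi
  -- With `f` the edge away from the root and `g` its reverse, `P_w f = f P_v g f = f g f P_v = f
  -- P_v`; the other direction is similar.
  · rw [T.proj_succ h hi, BSHom.comp_assoc, BSHom.comp_assoc, hcomm v w h hi, ← BSHom.comp_assoc,
      edgeMorphism_comp_comp]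
  · rw [T.proj_succ h.symm hi]
    exact (congrArg (T.proj w).comp (edgeMorphism_comp_comp h)).symm.trans
      (congrArg (fun f : BSHom w.1 w.1 => f.comp (edgeMorphism h)) (hcomm w v h.symm hi))

end RootMaps

/-- The conjecture holds when the reduced expression graph is a line along which the projectors to
both ends form natural families. -/
theorem forkingPathConjecture_of_rootMaps {idx idx' : ReducedExpr σ → ℕ} {a b : ReducedExpr σ}
    (T : RootMaps idx a) (T' : RootMaps idx' b)
    (hadj : ∀ v w, (rexGraph σ).Adj v w → idx v + 1 = idx w ∨ idx w + 1 = idx v)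
    (hanti : ∀ v w, (rexGraph σ).Adj v w → idx v + 1 = idx w → idx' w + 1 = idx' v)
    (hT : IsNatural T.proj) (hT' : IsNatural T'.proj) : ForkingPathConjecture σ := by
  -- A step towards `a` is part of the monotone walk. A step away from `a` produces a round trip
  -- after `P'_v`, and this is absorbed because `P'_v` ends with the reverse of that edge.
  have habsorb : ∀ v w (h : (rexGraph σ).Adj v w),
      ((T.toRoot w).comp (edgeMorphism h)).comp ((T'.proj v).comp (T.proj v)) =
        (T.toRoot v).comp ((T'.proj v).comp (T.proj v)) := by
    intro v w h
    rcases hadj v w h with hi | hi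
    · have h1 : ((edgeMorphism h.symm).comp (edgeMorphism h)).comp (T'.proj v) = T'.proj v := by
        rw [T'.proj_succ h.symm (hanti v w h hi)]
        exact congrArg (fun f : BSHom w.1 v.1 => f.comp ((T'.proj w).comp (edgeMorphism h)))
          (edgeMorphism_comp_comp h.symm)
      rw [T.toRoot_succ v w h hi]
      exact congrArg (fun f => (T.toRoot v).comp (f.comp (T.proj v))) h1
    · rw [T.toRoot_succ w v h.symm hi]
  have hwalk : ∀ (v w : ReducedExpr σ) (p : (rexGraph σ).Walk v w),
      ((T.toRoot w).comp (pathMorphism p)).comp ((T'.proj v).comp (T.proj v)) =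
        (T.toRoot v).comp ((T'.proj v).comp (T.proj v)) := by
    intro v w p
    induction p with
    | nil => rfl
    | @cons v u w h p ih =>
      have hn : (edgeMorphism h).comp ((T'.proj v).comp (T.proj v)) =
          ((T'.proj u).comp (T.proj u)).comp (edgeMorphism h) := by
        rw [← BSHom.comp_assoc, ← hT', BSHom.comp_assoc, ← hT, BSHom.comp_assoc]
      rw [← habsorb v u h, BSHom.comp_assoc (T.toRoot u), hn, ← BSHom.comp_assoc (T.toRoot u), ← ih,
        BSHom.comp_assoc _ _ (edgeMorphism h), ← hn]
      rfl
  -- Completeness enters only through the visits to the two ends. The right-hand side does not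
  -- involve `p`.
  have hfull : ∀ (v w : ReducedExpr σ) (p : (rexGraph σ).Walk v w), (∀ u, u ∈ p.support) →
      pathMorphism p = (T.fromRoot w).comp ((T.toRoot v).comp ((T'.proj v).comp (T.proj v))) := by
    intro v w p hp
    have h1 := hT.comp_pathMorphism_of_mem T.proj_root p (hp a)
    have h2 := hT'.comp_pathMorphism_of_mem T'.proj_root p (hp b)
    have h3 : (pathMorphism p).comp ((T'.proj v).comp (T.proj v)) = pathMorphism p := by
      rw [← BSHom.comp_assoc, ← hT'.comp_pathMorphism, h2, ← hT.comp_pathMorphism, h1]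
    rw [← hwalk v w p]
    exact ((congrArg (fun f => (T.proj w).comp f) h3).trans h1).symm
  intro v w p q hp hq
  rw [hfull v w p hp, hfull v w q hq]

/-- A word `i j i k i` with `i` adjacent to the distinct letters `j` and `k`. -/
def IsDoubleBraid (w : List (Fin n)) : Prop :=
  ∃ i j k, Adjacent i j ∧ Adjacent i k ∧ j ≠ k ∧ w = [i, j, i, k, i]

/-- A condition on the edge from `v` to `w` under which the projector at `v` to the root commutes
with the round trip along the edge. -/
theorem RootMaps.comm_of_cases {idx : ReducedExpr σ → ℕ} {a : ReducedExpr σ} (T : RootMaps idx a)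
    (hidx : Function.Injective idx) (ha : idx a = 0) {v w : ReducedExpr σ}
    (h : (rexGraph σ).Adj v w)
    (hc : DistantEdge v w ∨ idx v = 0 ∨
      ∃ u, idx u + 1 = idx v ∧ ((idx u = 0 ∧ DistantEdge v u) ∨
        (IsDoubleBraid v.1 ∧ (rexGraph σ).Adj u v ∧
          ∃ u', idx u' = 0 ∧ idx u' + 1 = idx u ∧ DistantEdge u u'))) :
    (T.proj v).comp ((edgeMorphism h.symm).comp (edgeMorphism h)) =
      ((edgeMorphism h.symm).comp (edgeMorphism h)).comp (T.proj v) := by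
  have hroot : ∀ u, idx u = 0 → T.proj u = BSHom.id u.1 := by
    intro u hu
    obtain rfl := hidx (hu.trans ha.symm)
    exact T.proj_root
  rcases hc with hd | h0 | ⟨u, hi, ⟨h0, hd⟩ | ⟨⟨i, j, k, hij, hik, hjk, hv⟩, hu, u', h0, hi', hd⟩⟩
  · rw [edgeMorphism_comp_of_distantEdge h hd, BSHom.comp_id, BSHom.id_comp]
  · rw [hroot v h0, BSHom.comp_id, BSHom.id_comp]
  · rw [T.proj_succ_of_distantEdge hd hi (hroot u h0), BSHom.comp_id, BSHom.id_comp]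
  · rw [T.proj_succ_of_proj_eq_id hu hi (T.proj_succ_of_distantEdge hd hi' (hroot u' h0))]
    obtain ⟨m⟩ := id h
    obtain ⟨m'⟩ := hu.symm
    have e := edgeMorphism_symm_comp hu.symm m'
    rw [edgeMorphism_symm_comp h m, e]
    obtain ⟨v, hv'⟩ := v
    subst hv
    exact roundTrip_comm hij hik hjk m' m

end Line

/-! ### Enumeration of braid moves -/

section Moves

variable {n : ℕ}

instance (i j : Fin n) : Decidable (Distant i j) := inferInstanceAs (Decidable (_ ∨ _))

instance (i j : Fin n) : Decidable (Adjacent i j) := inferInstanceAs (Decidable (_ ∨ _))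

/-- The distant moves at the beginning of a word. -/
def headDistant : List (Fin n) → List (List (Fin n))
  | i :: j :: v => if Distant i j then [j :: i :: v] else []
  | _ => []

/-- The adjacent moves at the beginning of a word. -/
def headAdjacent : List (Fin n) → List (List (Fin n))
  | i :: j :: k :: v => if i = k ∧ Adjacent i j then [j :: i :: j :: v] else []
  | _ => []

/-- All results of distant moves. -/
def distantMoves : List (Fin n) → List (List (Fin n))
  | [] => []
  | i :: w => headDistant (i :: w) ++ (distantMoves w).map (List.cons i)

/-- All results of adjacent moves. -/
def adjacentMoves : List (Fin n) → List (List (Fin n))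
  | [] => []
  | i :: w => headAdjacent (i :: w) ++ (adjacentMoves w).map (List.cons i)

/-- Together with its converses this makes the existence of moves decidable, so the combinatorics of
the table can be computed. -/
theorem BraidMove.mem_moves {w w' : List (Fin n)} (m : BraidMove w w') :
    (m.IsDistant ∧ w' ∈ distantMoves w) ∨ (¬ m.IsDistant ∧ w' ∈ adjacentMoves w) := by
  induction m with
  | distant i j h v => exact Or.inl ⟨trivial, by simp [distantMoves, headDistant, h]⟩
  | adjacent i j h v =>
    exact Or.inr ⟨fun h => h, by simp [adjacentMoves, headAdjacent, h]⟩
  | cons a m ih =>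
    rcases ih with ⟨h, hm⟩ | ⟨h, hm⟩
    · exact Or.inl ⟨h, by simp [distantMoves, hm]⟩
    · exact Or.inr ⟨h, by simp [adjacentMoves, hm]⟩

theorem exists_of_mem_distantMoves {w : List (Fin n)} :
    ∀ {w'}, w' ∈ distantMoves w → ∃ m : BraidMove w w', m.IsDistant := by
  induction w with
  | nil => intro w' h; simp [distantMoves] at h
  | cons i w ih =>
    intro w' h
    rw [distantMoves, List.mem_append] at h
    rcases h with h | h
    · match w with
      | [] => simp [headDistant] at h
      | j :: v =>
        by_cases hd : Distant i j
        · simp only [headDistant, hd, if_true, List.mem_singleton] at h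
          subst h
          exact ⟨.distant i j hd v, trivial⟩
        · simp [headDistant, hd] at h
    · obtain ⟨u, hu, rfl⟩ := List.mem_map.1 h
      obtain ⟨m, hm⟩ := ih hu
      exact ⟨.cons i m, hm⟩

theorem nonempty_of_mem_adjacentMoves {w : List (Fin n)} :
    ∀ {w'}, w' ∈ adjacentMoves w → Nonempty (BraidMove w w') := by
  induction w with
  | nil => intro w' h; simp [adjacentMoves] at h
  | cons i w ih =>
    intro w' h
    rw [adjacentMoves, List.mem_append] at h
    rcases h with h | h
    · match w with
      | [] => simp [headAdjacent] at h
      | [_] => simp [headAdjacent] at h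
      | j :: k :: v =>
        by_cases hd : i = k ∧ Adjacent i j
        · simp only [headAdjacent, hd] at h
          obtain ⟨rfl, ha⟩ := hd
          simp only [ha, and_self, if_true, List.mem_singleton] at h
          subst h
          exact ⟨.adjacent i j ha v⟩
        · simp [headAdjacent, hd] at h
    · obtain ⟨u, hu, rfl⟩ := List.mem_map.1 h
      obtain ⟨m⟩ := ih hu
      exact ⟨.cons i m⟩

theorem exists_isDistant_iff {w w' : List (Fin n)} :
    (∃ m : BraidMove w w', m.IsDistant) ↔ w' ∈ distantMoves w := by
  refine ⟨fun ⟨m, hm⟩ => ?_, exists_of_mem_distantMoves⟩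
  rcases m.mem_moves with h | h
  exacts [h.2, absurd hm h.1]

theorem nonempty_braidMove_iff {w w' : List (Fin n)} :
    Nonempty (BraidMove w w') ↔ w' ∈ distantMoves w ∨ w' ∈ adjacentMoves w := by
  constructor
  · rintro ⟨m⟩
    rcases m.mem_moves with h | h
    exacts [Or.inl h.2, Or.inr h.2]
  · rintro (h | h)
    · exact ⟨(exists_of_mem_distantMoves h).choose⟩
    · exact nonempty_of_mem_adjacentMoves h

instance (w w' : List (Fin n)) : Decidable (Nonempty (BraidMove w w')) :=
  decidable_of_iff _ nonempty_braidMove_iff.symm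

instance (w w' : List (Fin n)) : Decidable (∃ m : BraidMove w w', m.IsDistant) :=
  decidable_of_iff _ exists_isDistant_iff.symm

instance (w : List (Fin n)) : Decidable (IsDoubleBraid w) :=
  inferInstanceAs (Decidable (∃ i j k, Adjacent i j ∧ Adjacent i k ∧ j ≠ k ∧ w = [i, j, i, k, i]))

end Moves

/-! ### Lists of words forming a line -/

section Table

variable {n : ℕ}

/-- The words of length `k`. -/
def wordsOfLength (n : ℕ) : ℕ → List (List (Fin n))
  | 0 => [[]]
  | k + 1 => (wordsOfLength n k).flatMap fun w => (List.finRange n).map fun i => i :: w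

theorem mem_wordsOfLength : ∀ w : List (Fin n), w ∈ wordsOfLength n w.length
  | [] => by simp [wordsOfLength]
  | i :: w => by
    simp only [List.length_cons, wordsOfLength, List.mem_flatMap, List.mem_map, List.mem_finRange,
      true_and]
    exact ⟨w, mem_wordsOfLength w, i, rfl⟩

/-- `l` is the list of all reduced expressions, of length `k`, of `σ`. -/
def IsListOfReducedExprs (σ : Equiv.Perm (Fin (n + 1))) (k : ℕ) (l : List (List (Fin n))) : Prop :=
  l ≠ [] ∧ (∀ w ∈ l, wordProd w = σ ∧ w.length = k) ∧
    (∀ k' < k, ∀ w ∈ wordsOfLength n k', wordProd w ≠ σ) ∧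
    ∀ w ∈ wordsOfLength n k, wordProd w = σ → w ∈ l

instance (σ : Equiv.Perm (Fin (n + 1))) (k : ℕ) (l : List (List (Fin n))) :
    Decidable (IsListOfReducedExprs σ k l) := inferInstanceAs (Decidable (_ ∧ _ ∧ _ ∧ _))

/-- Minimality over all words becomes finite: every word of length less than `k` has been excluded,
and nonemptiness of `l` shows that `k` is attained. -/
theorem IsListOfReducedExprs.isReducedExpr_iff {σ : Equiv.Perm (Fin (n + 1))} {k : ℕ}
    {l : List (List (Fin n))} (h : IsListOfReducedExprs σ k l) (w : List (Fin n)) :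
    IsReducedExpr σ w ↔ w ∈ l := by
  obtain ⟨h0, h1, h2, h3⟩ := h
  have hle : ∀ w', wordProd w' = σ → k ≤ w'.length := by
    intro w' hw'
    by_contra hlt
    exact h2 _ (not_le.1 hlt) w' (mem_wordsOfLength w') hw'
  constructor
  · rintro ⟨hw, hmin⟩
    obtain ⟨u, hu⟩ := List.exists_mem_of_ne_nil l h0
    have hlen : w.length = k :=
      le_antisymm ((hmin u (h1 u hu).1).trans_eq (h1 u hu).2) (hle w hw)
    exact h3 w (hlen ▸ mem_wordsOfLength w) hw
  · intro hw
    exact ⟨(h1 w hw).1, fun w' hw' => (h1 w hw).2.trans_le (hle w' hw')⟩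

/-- The condition of `RootMaps.comm_of_cases` for the edge from `v` to `w`, the words being numbered
by their positions in `l`. -/
def IsGoodEdge (l : List (List (Fin n))) (v w : List (Fin n)) : Prop :=
  (∃ m : BraidMove v w, m.IsDistant) ∨ l.idxOf v = 0 ∨
    ∃ u ∈ l, l.idxOf u + 1 = l.idxOf v ∧
      ((l.idxOf u = 0 ∧ ∃ m : BraidMove v u, m.IsDistant) ∨
      (IsDoubleBraid v ∧ Nonempty (BraidMove u v) ∧
        ∃ u' ∈ l, l.idxOf u' = 0 ∧ l.idxOf u' + 1 = l.idxOf u ∧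
          ∃ m : BraidMove u u', m.IsDistant))

instance (l : List (List (Fin n))) (v w : List (Fin n)) : Decidable (IsGoodEdge l v w) := by
  unfold IsGoodEdge
  infer_instance

/-- The words in `l` form a line, and the edges satisfy the conditions of
`RootMaps.comm_of_cases`. -/
def IsLine (l : List (List (Fin n))) : Prop :=
  (∀ v ∈ l, ∀ w ∈ l, Nonempty (BraidMove v w) →
    l.idxOf v + 1 = l.idxOf w ∨ l.idxOf w + 1 = l.idxOf v) ∧
  (∀ v ∈ l, l.idxOf v ≠ 0 → ∃ w ∈ l, Nonempty (BraidMove w v) ∧ l.idxOf w + 1 = l.idxOf v) ∧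
  (∀ v ∈ l, ∀ w ∈ l, Nonempty (BraidMove v w) → l.idxOf v + 1 = l.idxOf w → IsGoodEdge l v w)

instance (l : List (List (Fin n))) : Decidable (IsLine l) := by
  unfold IsLine
  infer_instance

theorem IsLine.exists_isNatural {σ : Equiv.Perm (Fin (n + 1))} {l : List (List (Fin n))}
    (h : IsLine l) (h0 : l ≠ []) (hl : ∀ w, IsReducedExpr σ w ↔ w ∈ l) :
    ∃ (a : ReducedExpr σ) (T : RootMaps (fun v => l.idxOf v.1) a), IsNatural T.proj := by
  obtain ⟨h1, h2, h3⟩ := h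
  have hinj : Function.Injective fun v : ReducedExpr σ => l.idxOf v.1 := fun v w hvw =>
    Subtype.ext ((List.idxOf_inj ((hl _).1 v.2)).1 hvw)
  obtain ⟨x, l, rfl⟩ := List.exists_cons_of_ne_nil h0
  let a : ReducedExpr σ := ⟨x, (hl x).2 (by simp)⟩
  have ha : (x :: l).idxOf a.1 = 0 := List.idxOf_cons_self
  have hadj : ∀ v w, (rexGraph σ).Adj v w → (x :: l).idxOf v.1 + 1 = (x :: l).idxOf w.1 ∨
      (x :: l).idxOf w.1 + 1 = (x :: l).idxOf v.1 :=
    fun v w hvw => h1 _ ((hl _).1 v.2) _ ((hl _).1 w.2) hvw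
  obtain ⟨T⟩ := exists_rootMaps (σ := σ) hinj ha fun v hv => by
    obtain ⟨w, hw, hm, hi⟩ := h2 _ ((hl _).1 v.2) hv
    exact ⟨⟨w, (hl w).2 hw⟩, hm, hi⟩
  refine ⟨a, T, T.isNatural_proj hadj fun v w hvw hi => T.comm_of_cases hinj ha hvw ?_⟩
  rcases h3 _ ((hl _).1 v.2) _ ((hl _).1 w.2) hvw hi with
    hd | hv | ⟨u, hu, hiu, ⟨hu0, hd⟩ | ⟨hb, hm, u', hu', h0', hi', hd⟩⟩
  · exact Or.inl hd
  · exact Or.inr (Or.inl hv)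
  · exact Or.inr (Or.inr ⟨⟨u, (hl u).2 hu⟩, hiu, Or.inl ⟨hu0, hd⟩⟩)
  · exact Or.inr (Or.inr ⟨⟨u, (hl u).2 hu⟩, hiu, Or.inr ⟨hb, hm, ⟨u', (hl u').2 hu'⟩, h0', hi', hd⟩⟩)

theorem forkingPathConjecture_of_isLine {σ : Equiv.Perm (Fin (n + 1))} {k : ℕ}
    {l : List (List (Fin n))} (hl : IsListOfReducedExprs σ k l) (h : IsLine l)
    (h' : IsLine l.reverse)
    (hanti : ∀ v ∈ l, ∀ w ∈ l, l.idxOf v + 1 = l.idxOf w →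
      l.reverse.idxOf w + 1 = l.reverse.idxOf v) : ForkingPathConjecture σ := by
  have hr := hl.isReducedExpr_iff
  obtain ⟨a, T, hT⟩ := h.exists_isNatural hl.1 hr
  obtain ⟨b, T', hT'⟩ := h'.exists_isNatural (σ := σ) (by simpa using hl.1)
    (fun w => (hr w).trans List.mem_reverse.symm)
  exact forkingPathConjecture_of_rootMaps T T'
    (fun v w hvw => h.1 _ ((hr _).1 v.2) _ ((hr _).1 w.2) hvw)
    (fun v w _ hi => hanti _ ((hr _).1 v.2) _ ((hr _).1 w.2) hi) hT hT'

/-- The reduced expressions of the elements of `S_4` other than `12321` and the longest element. -/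
def reducedExprTable : List (List (List (Fin 3))) :=
  [[[]], [[0]], [[1]], [[2]], [[0, 1]], [[1, 0]], [[1, 2]], [[2, 1]], [[0, 2], [2, 0]],
    [[0, 1, 0], [1, 0, 1]], [[1, 2, 1], [2, 1, 2]], [[0, 1, 2]], [[2, 1, 0]],
    [[0, 2, 1], [2, 0, 1]], [[1, 0, 2], [1, 2, 0]],
    [[1, 0, 1, 2], [0, 1, 0, 2], [0, 1, 2, 0]], [[2, 1, 0, 1], [2, 0, 1, 0], [0, 2, 1, 0]],
    [[0, 1, 2, 1], [0, 2, 1, 2], [2, 0, 1, 2]], [[1, 2, 1, 0], [2, 1, 2, 0], [2, 1, 0, 2]],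
    [[1, 0, 2, 1], [1, 2, 0, 1]],
    [[0, 1, 2, 0, 1], [0, 1, 0, 2, 1], [1, 0, 1, 2, 1], [1, 0, 2, 1, 2], [1, 2, 0, 1, 2]],
    [[1, 0, 2, 1, 0], [1, 2, 0, 1, 0], [1, 2, 1, 0, 1], [2, 1, 2, 0, 1], [2, 1, 0, 2, 1]]]

theorem isListOfReducedExprs_table : ∀ l ∈ reducedExprTable,
    IsListOfReducedExprs (wordProd (l.headD [])) (l.headD []).length l := by
  decide +kernel

/-- The reversed list provides the projectors to the other end. The double braid case of
`IsGoodEdge` is needed only for the two lists of five words, at their middle word. -/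
theorem isLine_table : ∀ l ∈ reducedExprTable, IsLine l ∧ IsLine l.reverse ∧
    ∀ v ∈ l, ∀ w ∈ l, l.idxOf v + 1 = l.idxOf w → l.reverse.idxOf w + 1 = l.reverse.idxOf v := by
  decide +kernel

theorem forkingPathConjecture_table {l : List (List (Fin 3))} (hl : l ∈ reducedExprTable) :
    ForkingPathConjecture (wordProd (l.headD []) : Equiv.Perm (Fin 4)) :=
  forkingPathConjecture_of_isLine (isListOfReducedExprs_table l hl) (isLine_table l hl).1
    (isLine_table l hl).2.1 (isLine_table l hl).2.2

/-- `Fin.revPerm` is the longest element; the `22` other remaining permutations each have an entry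
in the table. -/
theorem exists_mem_table : ∀ σ : Equiv.Perm (Fin 4), σ ≠ wordProd [0, 1, 2, 1, 0] →
    σ ≠ Fin.revPerm → ∃ l ∈ reducedExprTable, wordProd (l.headD []) = σ := by
  decide +kernel

theorem forkingPathConjecture_of_ne {σ : Equiv.Perm (Fin 4)} (h : σ ≠ wordProd [0, 1, 2, 1, 0])
    (h' : σ ≠ Fin.revPerm) : ForkingPathConjecture σ := by
  obtain ⟨l, hl, rfl⟩ := exists_mem_table σ h h'
  exact forkingPathConjecture_table hl

end Table

/-! ### The conflated expression graph of `23121` -/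

section Conflated

/-- The reduced expressions of `23121`. -/
def lineWords : List (List (Fin 3)) :=
  [[1, 0, 2, 1, 0], [1, 2, 0, 1, 0], [1, 2, 1, 0, 1], [2, 1, 2, 0, 1], [2, 1, 0, 2, 1]]

theorem isReducedExpr_lineWords (w : List (Fin 3)) :
    IsReducedExpr (wordProd [1, 2, 0, 1, 0] : Equiv.Perm (Fin 4)) w ↔ w ∈ lineWords := by
  have h : IsListOfReducedExprs (wordProd [1, 2, 0, 1, 0] : Equiv.Perm (Fin 4)) 5 lineWords := by
    decide +kernel
  exact h.isReducedExpr_iff w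

/-- The class of a reduced expression of `23121` in the conflated expression graph. -/
def lineLevel (w : List (Fin 3)) : Fin 3 :=
  if lineWords.idxOf w < 2 then 0 else if lineWords.idxOf w = 2 then 1 else 2

/-- Representatives of the classes of reduced expressions of `23121`. -/
def lineRep : Fin 3 → List (Fin 3) :=
  ![[1, 2, 0, 1, 0], [1, 2, 1, 0, 1], [2, 1, 2, 0, 1]]

theorem lineRep_mem : ∀ k, lineRep k ∈ lineWords := by decide +kernel

theorem lineLevel_lineRep : ∀ k, lineLevel (lineRep k) = k := by decide +kernel

theorem lineLevel_eq_of_isDistant : ∀ v ∈ lineWords, ∀ w ∈ lineWords,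
    (∃ m : BraidMove v w, m.IsDistant) → lineLevel v = lineLevel w := by decide +kernel

theorem lineRep_lineLevel : ∀ v ∈ lineWords,
    v = lineRep (lineLevel v) ∨ ∃ m : BraidMove (lineRep (lineLevel v)) v, m.IsDistant := by
  decide +kernel

theorem lineLevel_of_braidMove : ∀ v ∈ lineWords, ∀ w ∈ lineWords, Nonempty (BraidMove v w) →
    lineLevel v = lineLevel w ∨ (lineLevel v : ℕ) + 1 = lineLevel w ∨
      (lineLevel w : ℕ) + 1 = lineLevel v := by decide +kernel

/-- The representatives are the ends of the two adjacent edges, so consecutive ones are joined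
directly. -/
theorem braidMove_lineRep : ∀ k l : Fin 3, (k : ℕ) + 1 = l →
    Nonempty (BraidMove (lineRep k) (lineRep l)) := by decide +kernel

/-- The conflated expression graph of `23121` is a line with three vertices. -/
theorem nonempty_conflatedGraph_iso :
    Nonempty (conflatedGraph (wordProd [1, 2, 0, 1, 0] : Equiv.Perm (Fin 4)) ≃g
      SimpleGraph.pathGraph 3) := by
  have hmem : ∀ v : ReducedExpr (wordProd [1, 2, 0, 1, 0] : Equiv.Perm (Fin 4)),
      v.1 ∈ lineWords := fun v => (isReducedExpr_lineWords _).1 v.2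
  let lev : Quot (DistantEdge (σ := (wordProd [1, 2, 0, 1, 0] : Equiv.Perm (Fin 4)))) → Fin 3 :=
    Quot.lift (fun v => lineLevel v.1) fun v w h =>
      lineLevel_eq_of_isDistant _ (hmem v) _ (hmem w) h
  let rep : Fin 3 → ReducedExpr (wordProd [1, 2, 0, 1, 0] : Equiv.Perm (Fin 4)) := fun k =>
    ⟨lineRep k, (isReducedExpr_lineWords _).2 (lineRep_mem k)⟩
  -- Each word is its representative or one distant move away, so the level determines the class.
  have hleft : ∀ x, Quot.mk _ (rep (lev x)) = x := by
    rintro ⟨v⟩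
    rcases lineRep_lineLevel _ (hmem v) with h | h
    · exact congrArg (Quot.mk _) (Subtype.ext h.symm)
    · exact Quot.sound h
  have hright : ∀ k, lev (Quot.mk _ (rep k)) = k := lineLevel_lineRep
  have hinj : Function.Injective lev := Function.LeftInverse.injective (g := fun k => Quot.mk _ (rep k)) hleft
  refine ⟨⟨⟨lev, fun k => Quot.mk _ (rep k), hleft, hright⟩, ?_⟩⟩
  intro x y
  change (SimpleGraph.pathGraph 3).Adj (lev x) (lev y) ↔ _
  rw [SimpleGraph.pathGraph_adj, conflatedGraph, SimpleGraph.fromRel_adj]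
  constructor
  · intro h
    refine ⟨?_, ?_⟩
    · rintro rfl
      omega
    · rcases h with h | h
      · exact Or.inl ⟨_, _, hleft x, hleft y, braidMove_lineRep _ _ h⟩
      · exact Or.inr ⟨_, _, hleft y, hleft x, braidMove_lineRep _ _ h⟩
  · rintro ⟨hne, ⟨v, w, rfl, rfl, h⟩ | ⟨v, w, rfl, rfl, h⟩⟩
    · rcases lineLevel_of_braidMove _ (hmem v) _ (hmem w) h with h | h | h
      · exact absurd (hinj h) hne
      · exact Or.inl h
      · exact Or.inr h
    · rcases lineLevel_of_braidMove _ (hmem v) _ (hmem w) h with h | h | h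
      · exact absurd (hinj h.symm) hne
      · exact Or.inr h
      · exact Or.inl h

end Conflated

end ForkingPath

end

open ForkingPath in
theorem proposition3p12 :
    -- the braid morphisms of `S_4` are well defined
    (∀ i j : Fin 3, Distant i j → ∃! f : BSHom [i, j] [j, i], IsBraidMorphism f) ∧
    (∀ i j : Fin 3, Adjacent i j → ∃! f : BSHom [i, j, i] [j, i, j], IsBraidMorphism f) ∧
    -- the conflated expression graph of `23121` is a line with three vertices
    Nonempty (conflatedGraph (wordProd [1, 2, 0, 1, 0] : Equiv.Perm (Fin 4)) ≃g
      SimpleGraph.pathGraph 3) ∧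
    -- the conjecture for `23121` and for `12312`
    ForkingPathConjecture (wordProd [1, 2, 0, 1, 0] : Equiv.Perm (Fin 4)) ∧
    ForkingPathConjecture (wordProd [0, 1, 2, 0, 1] : Equiv.Perm (Fin 4)) ∧
    -- the conjecture for all elements other than `12321` and the longest element
    (∀ σ : Equiv.Perm (Fin 4), σ ≠ wordProd [0, 1, 2, 1, 0] → σ ≠ Fin.revPerm →
      ForkingPathConjecture σ) :=
  ⟨fun _ _ h => h.existsUnique, fun _ _ h => h.existsUnique, nonempty_conflatedGraph_iso,
    forkingPathConjecture_of_ne (by decide +kernel) (by decide +kernel),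
    forkingPathConjecture_of_ne (by decide +kernel) (by decide +kernel),
    fun _ h h' => forkingPathConjecture_of_ne h h'⟩
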